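/- Let $k$ be a field, let $H$ be a finite-dimensional Hopf algebra over $k$ with counit $\varepsilon$ and comultiplication $\Delta(h)=\sum h_{(1)}\otimes h_{(2)}$, and let $R\subseteq H$ be a Hopf subalgebra. Suppose that $H\supseteq R$ is a semisimple extension, i.e. every right $H$-module $N$ is isomorphic to a direct summand of $N\otimes_R H$ as a right $H$-module, or every left $H$-module $N$ is isomorphic to a direct summand of $H\otimes_R N$ as a left $H$-module. For a finite-dimensional Hopf algebra $A$ over $k$ (here $A=H$ or $A=R$), the modular function of $A$ is the unique algebra homomorphism $m_A:A\to k$ with $at=m_A(a)t$ for all $a\in A$, where $t\neq 0$ is a right integral in $A$ (that is, $ta=\varepsilon(a)t$ for all $a\in A$); the Nakayama automorphism of $A$ is the unique algebra automorphism $\eta_A:A\to A$ with $\varphi(ab)=\varphi(\eta_A(b)a)$ for all $a,b\in A$, where $\varphi\neq 0$ is a right integral in $A^*$ (that is, $\sum\varphi(a_{(1)})a_{(2)}=\varphi(a)1$ for all $a\in A$). Then: 1. the modular functions $m_H$ and $m_R$ exist and are unique, and $m_H|_R=m_R$; 2. the Nakayama automorphisms $\eta_H$ and $\eta_R$ exist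 and are unique, and $\eta_H|_R=\eta_R$; 3. $H\supseteq R$ is an ordinary (untwisted) Frobenius extension: there are an $R$-$R$-bimodule homomorphism $E:H\to R$ and elements $x_1,\dots,x_m,y_1,\dots,y_m\in H$ with $\sum_i E(hx_i)y_i=h=\sum_i x_iE(y_ih)$ for all $h\in H$. -/

import Mathlib

open scoped TensorProduct MulOpposite

universe uA uB uN

namespace RingExt

section

variable {B : Type uB} {A : Type uA} [Ring B] [Ring A]

/-- The induced right `A`-module `N ⊗_B A` of a right `A`-module `N` (restricted to `B` along
`f : B → A`).  It is the quotient of `A ⊗_ℤ N` (the two tensor factors are written in the order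
`a ⊗ n` in place of `n ⊗ a`, and `A` acts by right multiplication on the factor `A`) by the
relations `n ⊗ b a = n b ⊗ a`.  Right `A`-modules are modules over `Aᵐᵒᵖ`. -/
abbrev InducedRight (f : B →+* A) (N : Type uN) [AddCommGroup N] [Module Aᵐᵒᵖ N] : Type _ :=
  (A ⊗[ℤ] N) ⧸ (Submodule.span Aᵐᵒᵖ
    {x : A ⊗[ℤ] N | ∃ (b : B) (a : A) (n : N),
      x = (f b * a) ⊗ₜ[ℤ] n - a ⊗ₜ[ℤ] (MulOpposite.op (f b) • n)})

/-- The induced left `A`-module `A ⊗_B N` of a left `A`-module `N`: the quotient of `A ⊗_ℤ N` by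
the relations `a b ⊗ n = a ⊗ b n`. -/
abbrev InducedLeft (f : B →+* A) (N : Type uN) [AddCommGroup N] [Module A N] : Type _ :=
  (A ⊗[ℤ] N) ⧸ (Submodule.span A
    {x : A ⊗[ℤ] N | ∃ (b : B) (a : A) (n : N),
      x = (a * f b) ⊗ₜ[ℤ] n - a ⊗ₜ[ℤ] (f b • n)})

/-- `f : B → A` is a right semisimple extension: every right `A`-module `N` is relatively
projective, that is, isomorphic to a direct summand of `N ⊗_B A` as a right `A`-module. -/
def IsRightSemisimpleExtension (f : B →+* A) : Prop :=
  ∀ (N : Type uA) [AddCommGroup N] [Module Aᵐᵒᵖ N],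
    ∃ (i : N →ₗ[Aᵐᵒᵖ] InducedRight f N) (p : InducedRight f N →ₗ[Aᵐᵒᵖ] N),
      p ∘ₗ i = LinearMap.id

/-- `f : B → A` is a left semisimple extension: every left `A`-module `N` is isomorphic to a
direct summand of `A ⊗_B N` as a left `A`-module. -/
def IsLeftSemisimpleExtension (f : B →+* A) : Prop :=
  ∀ (N : Type uA) [AddCommGroup N] [Module A N],
    ∃ (i : N →ₗ[A] InducedLeft f N) (p : InducedLeft f N →ₗ[A] N),
      p ∘ₗ i = LinearMap.id

/-- `f : B → A` is an (ordinary, untwisted) Frobenius extension: there is a Frobenius coordinate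
system `(E; x₁, …, xₘ, y₁, …, yₘ)`, where `E : A → B` is a `B`-`B`-bimodule homomorphism. -/
def IsFrobeniusExtension (f : B →+* A) : Prop :=
  ∃ (E : A →+ B) (m : ℕ) (x y : Fin m → A),
    (∀ (b : B) (a : A) (b' : B), E (f b * a * f b') = b * E a * b') ∧
    (∀ a : A, ∑ i, f (E (a * x i)) * y i = a) ∧
    (∀ a : A, ∑ i, x i * f (E (y i * a)) = a)

end

end RingExt

namespace HopfInt

section

variable (k : Type*) {H : Type*} [Field k] [Ring H] [HopfAlgebra k H]

/-- `t ∈ H` is a right integral: `t h = ε(h) t` for all `h ∈ H`. -/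
def IsRightIntegral (t : H) : Prop :=
  ∀ h : H, t * h = Coalgebra.counit (R := k) h • t

variable {k}

/-- `m : H → k` is the (right) modular function of `H`: `h t = m(h) t` for a nonzero right
integral `t` of `H`. -/
def IsModularFunction (m : H →ₐ[k] k) : Prop :=
  ∃ t : H, t ≠ 0 ∧ IsRightIntegral k t ∧ ∀ h : H, h * t = m h • t

/-- `φ` is a right integral in the dual algebra `H*`: `∑ φ(h₁) h₂ = φ(h) 1` for all `h`; that is,
`φ * p = p(1) φ` for all `p ∈ H*`, where `*` is the convolution product. -/
def IsRightIntegralOn (φ : Module.Dual k H) : Prop :=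
  ∀ h : H, TensorProduct.lid k H (φ.rTensor H (Coalgebra.comul (R := k) h)) = φ h • (1 : H)

/-- `η` is the Nakayama automorphism of the Hopf algebra `H`, the one with respect to the
Frobenius functional given by a nonzero right integral `φ` in `H*`: `φ(a b) = φ(η(b) a)`. -/
def IsNakayamaAutomorphism (η : H ≃ₐ[k] H) : Prop :=
  ∃ φ : Module.Dual k H, φ ≠ 0 ∧ IsRightIntegralOn φ ∧ ∀ a b : H, φ (a * b) = φ (η b * a)

end

end HopfInt

/-! Everything rests on integrals. If `t` is a nonzero left integral, `(t₁, S(t₂))` is a pair of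
dual bases for a nondegenerate right integral `φ` on `H` (`IsLeftIntegral.exists_isDualPair`). So
`S` is bijective, integrals are unique up to scalars, and the modular function `m` and the Nakayama
automorphism `η` exist and are unique.

Semisimplicity serves only to compare modular functions. Applied to the module of integrals of `H`,
it yields `s` with `ε(s) = 1` such that multiplying `s` by an integral of `R` gives an integral of
`H`. If this product is nonzero, moving `r ∈ R` past it, once as an integral of `H` and once through
the factor from `R`, gives `m_H(r) = m_R(r)`. That it is nonzero follows from a weak substitute for
freeness of `H` over `R`: left integrals of `H` lie in `l H` for any nonzero left integral `l` of
`R` (`IsLeftIntegral.exists_map_mul_eq`). This is proved by a dimension count on spaces of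
homomorphisms into `H`.

The formula `S²(a) = ∑ m(η(a)₁) η(a)₂` (`IsIntegralPair.antipode_antipode`) determines `η` from `S`
and `m`, so `η_H` restricts to `η_R`. Finally `E` is defined by `φ_H(h r) = φ_R(E(h) r)`. Agreement
of the Nakayama automorphisms makes it left `R`-linear, and writing an integral of `H` as `l z`
turns the dual bases of `H` over `k` into a coordinate system over `R`. -/

namespace HopfInt

open Coalgebra HopfAlgebra WithConv

/-! ### Convolution identities for the antipode -/

section Antipode

variable {k H : Type*} [Field k] [Ring H] [HopfAlgebra k H]

theorem comp_conv_one {C A B : Type*} [Ring A] [Ring B] [Algebra k A] [Algebra k B]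
    [AddCommGroup C] [Module k C] [Coalgebra k C] (h : A →ₐ[k] B) :
    toConv (h.toLinearMap ∘ₗ (1 : WithConv (C →ₗ[k] A)).ofConv) = 1 := by
  ext c
  simp

theorem comp_conv_mul {C A B : Type*} [Ring A] [Ring B] [Algebra k A] [Algebra k B]
    [AddCommGroup C] [Module k C] [Coalgebra k C] (h : A →ₐ[k] B) (f g : WithConv (C →ₗ[k] A)) :
    toConv (h.toLinearMap ∘ₗ (f * g).ofConv) =
      toConv (h.toLinearMap ∘ₗ f.ofConv) * toConv (h.toLinearMap ∘ₗ g.ofConv) := by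
  rw [LinearMap.algHom_comp_convMul_distrib]

variable (k H) in
theorem conv_comul :
    toConv (comul : H →ₗ[k] H ⊗[k] H) =
      toConv (Algebra.TensorProduct.includeLeft (R := k) (S := k) (A := H) (B := H)).toLinearMap *
      toConv (Algebra.TensorProduct.includeRight (R := k) (A := H) (B := H)).toLinearMap := by
  ext a
  rw [(ℛ k a).convMul_apply]
  simp [← (ℛ k a).eq]

theorem conv_comp_id_mul_comp_antipode {A : Type*} [Ring A] [Algebra k A] (f : H →ₐ[k] A) :
    toConv f.toLinearMap * toConv (f.toLinearMap ∘ₗ antipode k) = 1 := by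
  have := comp_conv_mul f (toConv LinearMap.id) (toConv (antipode k (A := H)))
  rw [LinearMap.id_mul_antipode, comp_conv_one] at this
  exact this.symm

theorem conv_comp_antipode_mul_comp_id {A : Type*} [Ring A] [Algebra k A] (f : H →ₐ[k] A) :
    toConv (f.toLinearMap ∘ₗ antipode k) * toConv f.toLinearMap = 1 := by
  have := comp_conv_mul f (toConv (antipode k (A := H))) (toConv LinearMap.id)
  rw [LinearMap.antipode_mul_id, comp_conv_one] at this
  exact this.symm

/-- The antipode is an anti-homomorphism of coalgebras. -/
theorem comul_antipode (a : H) :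
    comul (R := k) (antipode k a) =
      TensorProduct.comm k H H
        (TensorProduct.map (antipode k) (antipode k) (comul (R := k) a)) := by
  set i₁ := Algebra.TensorProduct.includeLeft (R := k) (S := k) (A := H) (B := H)
  set i₂ := Algebra.TensorProduct.includeRight (R := k) (A := H) (B := H)
  -- `Δ` is the convolution product of the two inclusions, so it has the left inverse `(i₂ S) * (i₁
  -- S)`. It must equal the right inverse `Δ ∘ S`.
  have h1 : toConv (i₂.toLinearMap ∘ₗ antipode k) * toConv (i₁.toLinearMap ∘ₗ antipode k) *
      toConv (comul : H →ₗ[k] H ⊗[k] H) = 1 := by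
    rw [conv_comul, mul_assoc, ← mul_assoc (toConv (i₁.toLinearMap ∘ₗ antipode k)),
      conv_comp_antipode_mul_comp_id, one_mul, conv_comp_antipode_mul_comp_id]
  have h := congr($(left_inv_eq_right_inv h1 (LinearMap.comul_right_inv (R := k) (C := H))) a)
  rw [(ℛ k a).convMul_apply] at h
  rw [← (ℛ k a).eq]
  simpa [i₁, i₂] using h.symm

/-- A homomorphism of bialgebras between Hopf algebras commutes with the antipodes. -/
theorem map_antipode {R : Type*} [Ring R] [HopfAlgebra k R] (ι : R →ₐc[k] H) (r : R) :
    ι (antipode k r) = antipode k (ι r) := by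
  have h1 := conv_comp_antipode_mul_comp_id (ι : R →ₐ[k] H)
  have h2 : toConv (ι : R →ₐ[k] H).toLinearMap *
      toConv (antipode k ∘ₗ (ι : R →ₐ[k] H).toLinearMap) = 1 := by
    have := LinearMap.convMul_comp_coalgHom_distrib (toConv LinearMap.id)
      (toConv (antipode k (A := H))) (ι : R →ₗc[k] H)
    rw [LinearMap.id_mul_antipode] at this
    apply WithConv.ofConv_injective
    refine Eq.trans this.symm ?_
    ext r
    simp
  exact congr($(left_inv_eq_right_inv h1 h2) r)

end Antipode

/-! ### Untwisting the diagonal action on `H ⊗ W` -/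

section Twist

variable {k H W : Type*} [Field k] [Ring H] [HopfAlgebra k H] [AddCommGroup W] [Module k W]
  (π : H →ₐ[k] Module.End k W)

/-- The endomorphism `g ⊗ w ↦ ∑ g₁ ⊗ σ(g₂) w` of `H ⊗ W`, for a representation `W` of `H`. -/
noncomputable def twist (σ : H →ₗ[k] H) : H ⊗[k] W →ₗ[k] H ⊗[k] W :=
  TensorProduct.lift <| LinearMap.flip
    { toFun w := LinearMap.lTensor H (π.toLinearMap.flip w ∘ₗ σ) ∘ₗ comul
      map_add' w w' := by simp [LinearMap.add_comp, LinearMap.lTensor_add]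
      map_smul' c w := by simp [LinearMap.smul_comp, LinearMap.lTensor_smul] }

theorem twist_tmul (σ : H →ₗ[k] H) (g : H) (w : W) :
    twist π σ (g ⊗ₜ w) = LinearMap.lTensor H (π.toLinearMap.flip w ∘ₗ σ) (comul g) := rfl

theorem twist_tmul_repr {ι : Type*} (σ : H →ₗ[k] H) (g : H) (w : W) (r : Repr k g ι) :
    twist π σ (g ⊗ₜ w) = ∑ i ∈ r.index, r.left i ⊗ₜ π (σ (r.right i)) w := by
  simp [twist_tmul, ← r.eq]

theorem twist_twist (σ τ : H →ₗ[k] H) (z : H ⊗[k] W) :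
    twist π σ (twist π τ z) = twist π (toConv σ * toConv τ).ofConv z := by
  induction z with
  | zero => simp
  | add x y hx hy => simp [hx, hy]
  | tmul g w =>
    have key := congr(LinearMap.lTensor H (π.toLinearMap.flip w ∘ₗ LinearMap.mul' k H ∘ₗ
      TensorProduct.map σ τ) $(sum_tmul_tmul_eq (ℛ k g) (fun i => ℛ k ((ℛ k g).left i))
        (fun i => ℛ k ((ℛ k g).right i))))
    rw [twist_tmul_repr π τ g w (ℛ k g), map_sum, twist_tmul_repr π _ g w (ℛ k g)]
    simp_rw [twist_tmul_repr π σ _ _ (ℛ k _)]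
    have e : ∀ a : H, (toConv σ * toConv τ).ofConv a =
        ∑ i ∈ (ℛ k a).index, σ ((ℛ k a).left i) * τ ((ℛ k a).right i) :=
      fun a => (ℛ k a).convMul_apply (toConv σ) (toConv τ)
    simpa [e, TensorProduct.tmul_sum] using key

theorem twist_convOne (z : H ⊗[k] W) : twist π (1 : WithConv (H →ₗ[k] H)).ofConv z = z := by
  induction z with
  | zero => simp
  | add x y hx hy => simp [hx, hy]
  | tmul g w =>
    have := congr(LinearMap.lTensor H (LinearMap.toSpanSingleton k W w)
      $(sum_tmul_counit_eq (R := k) (ℛ k g)))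
    rw [twist_tmul_repr π _ g w (ℛ k g)]
    simpa only [map_sum, LinearMap.lTensor_tmul, LinearMap.toSpanSingleton_apply, one_smul,
      LinearMap.convOne_def, ofConv_toConv, LinearMap.comp_apply, Algebra.linearMap_apply,
      AlgHom.commutes, Module.algebraMap_end_apply] using this

theorem twist_id_twist_antipode (z : H ⊗[k] W) :
    twist π LinearMap.id (twist π (antipode k) z) = z := by
  rw [twist_twist, LinearMap.id_mul_antipode, twist_convOne]

theorem twist_antipode_twist_id (z : H ⊗[k] W) :
    twist π (antipode k) (twist π LinearMap.id z) = z := by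
  rw [twist_twist, LinearMap.antipode_mul_id, twist_convOne]

variable {V : Type*} [AddCommGroup V] [Module k V]

/-- The diagonal representation on the tensor product of two representations. -/
noncomputable def diag {B : Type*} [Ring B] [Bialgebra k B] (ρ : B →ₐ[k] Module.End k V)
    (π : B →ₐ[k] Module.End k W) : B →ₐ[k] Module.End k (V ⊗[k] W) :=
  (Module.endTensorEndAlgHom.comp (Algebra.TensorProduct.map ρ π)).comp
    (Bialgebra.comulAlgHom k B)

theorem diag_repr {B : Type*} [Ring B] [Bialgebra k B] (ρ : B →ₐ[k] Module.End k V)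
    (π : B →ₐ[k] Module.End k W) {ι : Type*} (a : B) (r : Repr k a ι) :
    diag ρ π a = ∑ i ∈ r.index, TensorProduct.map (ρ (r.left i)) (π (r.right i)) := by
  simp only [diag, AlgHom.comp_apply, Bialgebra.comulAlgHom_apply, ← r.eq, map_sum,
    Algebra.TensorProduct.map_tmul, Module.endTensorEndAlgHom_apply]
  rfl

/-- Multiplicativity of `Δ` makes `g ⊗ w ↦ ∑ g₁ ⊗ g₂ w` carry multiplication on the first factor to
the diagonal action. The twist by `S` is its inverse, so the diagonal module `H ⊗ W` is free. -/
theorem diag_twist_id (a : H) (z : H ⊗[k] W) :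
    diag (Algebra.lmul k H) π a (twist π LinearMap.id z) =
      twist π LinearMap.id (LinearMap.rTensor W (LinearMap.mulLeft k a) z) := by
  induction z with
  | zero => simp
  | add x y hx hy => simp only [map_add, hx, hy]
  | tmul g w =>
    rw [LinearMap.rTensor_tmul, LinearMap.mulLeft_apply, twist_tmul, twist_tmul,
      Bialgebra.comul_mul, diag_repr _ _ a (ℛ k a), ← (ℛ k a).eq, ← (ℛ k g).eq]
    simp [Finset.sum_mul_sum]
    exact Finset.sum_comm

theorem twist_antipode_diag (a : H) (z : H ⊗[k] W) :
    twist π (antipode k) (diag (Algebra.lmul k H) π a z) =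
      LinearMap.rTensor W (LinearMap.mulLeft k a) (twist π (antipode k) z) := by
  conv_lhs => rw [← twist_id_twist_antipode π z, diag_twist_id, twist_antipode_twist_id]

end Twist

/-! ### Existence of integrals -/

section Integrals

variable {k H : Type*} [Field k] [Ring H] [HopfAlgebra k H]

variable (k) in
/-- `t ∈ H` is a left integral: `h t = ε(h) t` for all `h ∈ H`. -/
def IsLeftIntegral (t : H) : Prop :=
  ∀ h : H, h * t = counit (R := k) h • t

variable (k H) in
/-- The contragredient of the left regular representation: `(a λ)(x) = λ(S(a) x)`. -/
noncomputable def contragredient : H →ₐ[k] Module.End k (Module.Dual k H) :=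
  AlgHom.ofLinearMap (Module.Dual.transpose ∘ₗ (Algebra.lmul k H).toLinearMap ∘ₗ antipode k)
    (by ext; simp [Module.Dual.transpose_apply])
    (fun a b => by ext; simp [antipode_mul_antidistrib, Module.Dual.transpose_apply, mul_assoc])

theorem contragredient_apply (a : H) (f : Module.Dual k H) (x : H) :
    contragredient k H a f x = f (antipode k a * x) := rfl

theorem nontrivial_of_hopfAlgebra (k H : Type*) [Field k] [Ring H] [HopfAlgebra k H] :
    Nontrivial H := by
  refine ⟨1, 0, fun h => ?_⟩
  simpa using congr(counit (R := k) $h)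

variable [FiniteDimensional k H]

variable (k H) in
/-- The canonical isomorphism `H ⊗ H* ≃ End H`. -/
noncomputable def tensorDualEquivEnd : H ⊗[k] Module.Dual k H ≃ₗ[k] (H →ₗ[k] H) :=
  TensorProduct.comm k H (Module.Dual k H) ≪≫ₗ dualTensorHomEquiv k H H

theorem tensorDualEquivEnd_tmul (h : H) (f : Module.Dual k H) (x : H) :
    tensorDualEquivEnd k H (h ⊗ₜ f) x = f x • h := by
  simp [tensorDualEquivEnd]

theorem tensorDualEquivEnd_diag {ι : Type*} (a : H) (r : Repr k a ι)
    (z : H ⊗[k] Module.Dual k H) (x : H) :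
    tensorDualEquivEnd k H (diag (Algebra.lmul k H) (contragredient k H) a z) x =
      ∑ i ∈ r.index, r.left i * tensorDualEquivEnd k H z (antipode k (r.right i) * x) := by
  induction z with
  | zero => simp
  | add x y hx hy => simp [hx, hy, mul_add, Finset.sum_add_distrib]
  | tmul h f =>
    rw [diag_repr _ _ a r]
    simp [tensorDualEquivEnd_tmul, contragredient_apply]

variable (k H) in
/-- A finite-dimensional Hopf algebra has a nonzero left integral. -/
theorem exists_isLeftIntegral : ∃ t : H, t ≠ 0 ∧ IsLeftIntegral k t := by
  have := nontrivial_of_hopfAlgebra k H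
  set z := (tensorDualEquivEnd k H).symm LinearMap.id with hz
  set u := twist (contragredient k H) (antipode k) z with hu
  have hz0 : z ≠ 0 := by
    intro h
    have : (LinearMap.id : H →ₗ[k] H) = 0 := by
      rw [← (tensorDualEquivEnd k H).apply_symm_apply LinearMap.id, ← hz, h, map_zero]
    exact one_ne_zero (congr($this (1 : H)))
  have hu0 : u ≠ 0 := by
    intro h
    apply hz0
    rw [← twist_id_twist_antipode (contragredient k H) z, ← hu, h, map_zero]
  -- The identity of `H` is invariant for the diagonal action on `End H`, since `∑ a₁ S(a₂) x = ε(a)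
  -- x`. Untwisting yields an invariant for multiplication on the first factor alone, each of whose
  -- coordinates is a left integral.
  have hinv : ∀ a : H, LinearMap.rTensor _ (LinearMap.mulLeft k a) u = counit (R := k) a • u := by
    intro a
    rw [hu, ← twist_antipode_diag, ← map_smul]
    congr 1
    apply (tensorDualEquivEnd k H).injective
    ext x
    rw [tensorDualEquivEnd_diag a (ℛ k a)]
    simp only [hz, map_smul, LinearEquiv.apply_symm_apply, LinearMap.id_apply,
      LinearMap.smul_apply, ← mul_assoc, ← Finset.sum_mul, sum_mul_antipode_eq_smul, smul_mul_assoc,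
      one_mul]
  classical
  let b := Module.finBasis k (Module.Dual k H)
  obtain ⟨i, hi⟩ : ∃ i, TensorProduct.equivFinsuppOfBasisRight b u i ≠ 0 := by
    by_contra! h
    exact hu0 ((TensorProduct.equivFinsuppOfBasisRight (M := H) b).map_eq_zero_iff.mp
      (Finsupp.ext h))
  refine ⟨_, hi, fun a => ?_⟩
  have e : ∀ v : H ⊗[k] Module.Dual k H, a * TensorProduct.equivFinsuppOfBasisRight b v i =
      TensorProduct.equivFinsuppOfBasisRight b (LinearMap.rTensor _ (LinearMap.mulLeft k a) v) i := by
    intro v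
    induction v with
    | zero => simp
    | add x y hx hy => simp only [map_add, Finsupp.add_apply, mul_add, hx, hy]
    | tmul x y => simp
  rw [e, hinv, map_smul, Finsupp.smul_apply]

-- For `T = u ⊗ v` the left side is `∑ a₁ u ⊗ S(v) S(a₂) a₃`, where `S(a₂) a₃` collapses to a
-- counit. Taking `T = Δ(t)` gives the exchange rule for integrals.
omit [FiniteDimensional k H] in
theorem sum_mulRight_antipode_comul_mul {ι : Type*} (a : H) (r : Repr k a ι) (T : H ⊗[k] H) :
    ∑ i ∈ r.index, LinearMap.lTensor H (LinearMap.mulRight k (r.right i))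
      (LinearMap.lTensor H (antipode k) (comul (r.left i) * T)) =
      LinearMap.rTensor H (LinearMap.mulLeft k a) (LinearMap.lTensor H (antipode k) T) := by
  induction T with
  | zero => simp
  | add x y hx hy => simp only [mul_add, map_add, Finset.sum_add_distrib, hx, hy]
  | tmul u v =>
    have key := congr(TensorProduct.map (LinearMap.mulRight k u)
      (LinearMap.mulLeft k (antipode k v) ∘ₗ LinearMap.mul' k H ∘ₗ
      LinearMap.rTensor H (antipode k)) $(sum_tmul_tmul_eq r (fun i => ℛ k (r.left i))
        (fun i => ℛ k (r.right i))))
    have key2 := congr(TensorProduct.map (LinearMap.mulRight k u)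
      (LinearMap.toSpanSingleton k H (antipode k v)) $(sum_tmul_counit_eq (R := k) r))
    simp_rw [← (ℛ k (r.left _)).eq]
    simp [Finset.sum_mul, antipode_mul_antidistrib, ← mul_assoc] at key ⊢
    rw [key]
    simp_rw [← TensorProduct.tmul_sum, mul_assoc, ← Finset.mul_sum, sum_antipode_mul_eq_smul]
    simpa only [map_sum, TensorProduct.map_tmul, LinearMap.toSpanSingleton_apply, one_smul,
      LinearMap.mulRight_apply, mul_smul_comm, mul_one] using key2

omit [FiniteDimensional k H] in
/-- For a left integral `t`, `∑ a t₁ ⊗ S(t₂) = ∑ t₁ ⊗ S(t₂) a`. -/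
theorem IsLeftIntegral.mul_tmul_antipode {t : H} (ht : IsLeftIntegral k t) {ι : Type*}
    (r : Repr k t ι) (a : H) :
    ∑ i ∈ r.index, (a * r.left i) ⊗ₜ[k] antipode k (r.right i) =
      ∑ i ∈ r.index, r.left i ⊗ₜ[k] (antipode k (r.right i) * a) := by
  have h := sum_mulRight_antipode_comul_mul a (ℛ k a) (comul (R := k) t)
  simp_rw [← Bialgebra.comul_mul, ht _, map_smul] at h
  have e : ∀ z : H ⊗[k] H, ∑ i ∈ (ℛ k a).index, counit (R := k) ((ℛ k a).left i) •
      LinearMap.lTensor H (LinearMap.mulRight k ((ℛ k a).right i)) z =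
      LinearMap.lTensor H (LinearMap.mulRight k a) z := by
    intro z
    induction z with
    | zero => simp
    | add x y hx hy => simp only [map_add, smul_add, Finset.sum_add_distrib, hx, hy]
    | tmul x y =>
      conv_rhs => rw [← sum_counit_smul (R := k) (ℛ k a)]
      simp [TensorProduct.tmul_sum, Finset.mul_sum]
  rw [e, ← r.eq] at h
  simpa using h.symm

end Integrals

/-! ### Dual bases from an integral -/

section Frobenius

variable {k H : Type*} [Field k] [Ring H] [HopfAlgebra k H]

/-- The functional `φ` and the left integral `t` are dual to each other: `(x, S(y))`, for
`Δ(t) = ∑ x ⊗ y`, is a pair of dual bases for the Frobenius functional `φ`. -/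
structure IsDualPair (t : H) (φ : Module.Dual k H) {n : ℕ} (x y : Fin n → H) : Prop where
  comul_eq : comul (R := k) t = ∑ i, x i ⊗ₜ y i
  sum_smul_antipode : ∀ a, ∑ i, φ (a * x i) • antipode k (y i) = a
  sum_smul : ∀ a, ∑ i, φ (antipode k (y i) * a) • x i = a

/-- With `g(t) = 1`, expand `∑ g(t₁) S(S(t₂) t₃) = g(t) 1`. Since `S` reverses products, the summand
is `g(t₁) S(t₃) S²(t₂)`. -/
theorem IsLeftIntegral.exists_one_eq {t : H} (ht0 : t ≠ 0) {n : ℕ} (r : Repr k t (Fin n))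
    (hr : r.index = Finset.univ) :
    ∃ u : Fin n → H, 1 = ∑ i, antipode k (r.right i) * u i := by
  obtain ⟨g, hg⟩ : ∃ g : Module.Dual k H, g t = 1 := by
    obtain ⟨g, hg⟩ : ∃ g : Module.Dual k H, g t ≠ 0 := by
      by_contra! h
      exact ht0 ((Module.forall_dual_apply_eq_zero_iff k t).mp h)
    exact ⟨(g t)⁻¹ • g, by simp [hg]⟩
  refine ⟨fun i => ∑ j ∈ (ℛ k (r.left i)).index, g ((ℛ k (r.left i)).left j) •
    antipode k (antipode k ((ℛ k (r.left i)).right j)), ?_⟩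
  have key := congr(TensorProduct.lid k H (TensorProduct.map g (antipode k ∘ₗ LinearMap.mul' k H ∘ₗ
      LinearMap.rTensor H (antipode k)) $(sum_tmul_tmul_eq r (fun i => ℛ k (r.left i))
        (fun i => ℛ k (r.right i)))))
  have key2 := congr(TensorProduct.lid k k (TensorProduct.map g LinearMap.id
    $(sum_tmul_counit_eq (R := k) r)))
  simp only [map_sum, TensorProduct.map_tmul, LinearMap.comp_apply, LinearMap.rTensor_tmul,
    LinearMap.mul'_apply, TensorProduct.lid_tmul, antipode_mul_antidistrib,
    LinearMap.id_apply, smul_eq_mul, mul_one, hg] at key key2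
  simp_rw [← antipode_mul_antidistrib, ← Finset.smul_sum, ← map_sum, sum_antipode_mul_eq_smul,
    map_smul, antipode_one, smul_smul, ← Finset.sum_smul, key2, one_smul,
    antipode_mul_antidistrib] at key
  rw [← key, hr]
  simp [Finset.mul_sum]

/-- Coassociativity of `t` evaluates `∑ t₁ ⊗ S(t₂) φ(S(t₃))` in two ways: as `(id ⊗ S)Δ(1) = 1 ⊗ 1`,
and as the sum of `b i ⊗ (φ ⊗ id)Δ(S(y i))`. Comparing coefficients of `b i` shows that `φ` is a
right integral on the elements `S(y i)`. -/
theorem lid_rTensor_comul_antipode {t : H} {n : ℕ} (b : Module.Basis (Fin n) k H)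
    (y : Fin n → H) (hy : ∑ i, b i ⊗ₜ[k] y i = comul (R := k) t) (φ : Module.Dual k H)
    (h1 : ∑ i, φ (antipode k (y i)) • b i = 1) (i : Fin n) :
    TensorProduct.lid k H (φ.rTensor H (comul (R := k) (antipode k (y i)))) =
      φ (antipode k (y i)) • (1 : H) := by
  have e : ∀ a : H, TensorProduct.lid k H (φ.rTensor H (comul (R := k) (antipode k a))) =
      TensorProduct.rid k H (TensorProduct.map (antipode k) (φ ∘ₗ antipode k) (comul a)) := by
    intro a
    rw [comul_antipode, ← (ℛ k a).eq]
    simp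
  have key := congr(TensorProduct.map LinearMap.id ((TensorProduct.rid k H).toLinearMap ∘ₗ
    TensorProduct.map (antipode k) (φ ∘ₗ antipode k)) $(coassoc_apply (R := k) t))
  have e2 : ∀ z : H ⊗[k] H, TensorProduct.map LinearMap.id ((TensorProduct.rid k H).toLinearMap ∘ₗ
      TensorProduct.map (antipode k) (φ ∘ₗ antipode k)) (TensorProduct.assoc k H H H
        (comul.rTensor H z)) = LinearMap.lTensor H (antipode k) (comul (R := k)
          (TensorProduct.rid k H (LinearMap.lTensor H (φ ∘ₗ antipode k) z))) := by
    intro z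
    induction z with
    | zero => simp
    | add x y hx hy => simp only [map_add, hx, hy]
    | tmul u v =>
      rw [LinearMap.rTensor_tmul, ← (ℛ k u).eq]
      simp [TensorProduct.sum_tmul, ← (ℛ k u).eq, Finset.smul_sum]
  rw [e2, ← hy] at key
  simp only [map_sum, LinearMap.lTensor_tmul, TensorProduct.map_tmul, LinearMap.comp_apply,
    TensorProduct.rid_tmul, LinearEquiv.coe_coe, ← e, LinearMap.id_apply] at key
  rw [← map_sum, ← map_sum, h1, Bialgebra.comul_one, Algebra.TensorProduct.one_def,
    LinearMap.lTensor_tmul, antipode_one, ← h1, TensorProduct.sum_tmul] at key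
  simp_rw [h1, TensorProduct.smul_tmul] at key
  have := congr(TensorProduct.equivFinsuppOfBasisLeft b $key i)
  simpa [Finsupp.single_apply] using this.symm

variable [FiniteDimensional k H]

theorem IsLeftIntegral.exists_isDualPair {t : H} (ht0 : t ≠ 0) (ht : IsLeftIntegral k t) :
    Function.Bijective (antipode k (A := H)) ∧
      ∃ (φ : Module.Dual k H) (n : ℕ) (x y : Fin n → H),
        IsDualPair t φ x y ∧ IsRightIntegralOn φ := by
  classical
  set n := Module.finrank k H with hn
  let b : Module.Basis (Fin n) k H := Module.finBasis k H
  obtain ⟨c, hc⟩ := TensorProduct.eq_repr_basis_left b (comul (R := k) t)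
  rw [Finsupp.sum_fintype _ _ (by simp)] at hc
  let y : Fin n → H := c
  let r : Repr k t (Fin n) := ⟨Finset.univ, b, y, hc⟩
  have hmul : ∀ a, ∑ i, (a * b i) ⊗ₜ[k] antipode k (y i) =
      ∑ i, b i ⊗ₜ[k] (antipode k (y i) * a) := ht.mul_tmul_antipode r
  -- The exchange rule makes the span of the `S(y i)` a right ideal, and `1` lies in the right ideal
  -- that they generate.
  have hspan : ⊤ ≤ Submodule.span k (Set.range fun i => antipode k (y i)) := by
    obtain ⟨u, hu⟩ := IsLeftIntegral.exists_one_eq ht0 r rfl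
    intro a _
    rw [← one_mul a, hu, Finset.sum_mul]
    refine Submodule.sum_mem _ fun i _ => ?_
    rw [mul_assoc]
    have := congr(TensorProduct.lid k H (LinearMap.rTensor H (b.coord i) $(hmul (u i * a))))
    simp only [map_sum, LinearMap.rTensor_tmul, TensorProduct.lid_tmul, Module.Basis.coord_apply,
      Module.Basis.repr_self, Finsupp.single_apply, ite_smul, one_smul, zero_smul,
      Finset.sum_ite_eq', Finset.mem_univ, if_true] at this
    change antipode k (y i) * (u i * a) ∈ _
    rw [← this]
    exact Submodule.sum_mem _ fun j _ => Submodule.smul_mem _ _ (Submodule.subset_span ⟨j, rfl⟩)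
  have hsurj : Function.Surjective (antipode k (A := H)) := by
    rw [← LinearMap.range_eq_top, ← top_le_iff]
    refine hspan.trans (Submodule.span_le.mpr ?_)
    rintro _ ⟨i, rfl⟩
    exact ⟨_, rfl⟩
  have hinj := LinearMap.injective_iff_surjective.mpr hsurj
  let b' := basisOfTopLeSpanOfCardEqFinrank (fun i => antipode k (y i)) hspan (by simp [hn])
  have hb' : ∀ i, b' i = antipode k (y i) := fun i => by simp [b']
  -- Forced by the second dual basis identity at `a = 1`.
  let φ : Module.Dual k H := b'.constr k fun i => b.repr 1 i
  have hφ : ∀ i, φ (antipode k (y i)) = b.repr 1 i := fun i => by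
    rw [← hb', Module.Basis.constr_basis]
  have h1 : ∑ i, φ (antipode k (y i)) • b i = 1 := by
    simp_rw [hφ]
    exact b.sum_repr 1
  have h2 : ∀ a, ∑ i, φ (antipode k (y i) * a) • b i = a := by
    intro a
    have := congr(TensorProduct.rid k H (LinearMap.lTensor H φ $(hmul a)))
    simp only [map_sum, LinearMap.lTensor_tmul, TensorProduct.rid_tmul] at this
    rw [← this]
    simp_rw [← mul_smul_comm, ← Finset.mul_sum, h1, mul_one]
  have h3 : ∀ i j, φ (antipode k (y i) * b j) = if i = j then 1 else 0 := by
    intro i j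
    have := congr(b.repr $(h2 (b j)) i)
    simpa [Finsupp.single_apply, eq_comm] using this
  refine ⟨⟨hinj, hsurj⟩, φ, n, b, y, ⟨hc.symm, fun a => ?_, h2⟩, ?_⟩
  · conv_rhs => rw [← b'.sum_repr a]
    refine Finset.sum_congr rfl fun i _ => ?_
    rw [hb']
    congr 1
    conv_lhs => rw [← b'.sum_repr a]
    simp [hb', Finset.sum_mul, h3]
  · have hI := lid_rTensor_comul_antipode b y hc φ h1
    intro h
    rw [← b'.sum_repr h]
    simp only [map_sum, map_smul, hb', hI, Finset.sum_smul, smul_smul, smul_eq_mul]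

end Frobenius

/-! ### Uniqueness of integrals, modular function, Nakayama automorphism -/

section Modular

variable {k H : Type*} [Field k] [Ring H] [HopfAlgebra k H]

theorem IsDualPair.eq_zero_of_mul_right {t : H} {φ : Module.Dual k H} {n : ℕ} {x y : Fin n → H}
    (h : IsDualPair t φ x y) {a : H} (ha : ∀ b, φ (a * b) = 0) : a = 0 := by
  rw [← h.sum_smul_antipode a]
  simp [ha]

theorem IsDualPair.eq_zero_of_mul_left {t : H} {φ : Module.Dual k H} {n : ℕ} {x y : Fin n → H}
    (h : IsDualPair t φ x y) {a : H} (ha : ∀ b, φ (b * a) = 0) : a = 0 := by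
  rw [← h.sum_smul a]
  simp [ha]

theorem IsLeftIntegral.antipode {t : H} (ht : IsLeftIntegral k t)
    (hS : Function.Surjective (antipode k (A := H))) : IsRightIntegral k (antipode k t) := by
  intro h
  obtain ⟨a, rfl⟩ := hS h
  rw [← antipode_mul_antidistrib, ht, map_smul, counit_antipode]

theorem IsRightIntegralOn.sub {φ ψ : Module.Dual k H} (hφ : IsRightIntegralOn φ)
    (hψ : IsRightIntegralOn ψ) : IsRightIntegralOn (φ - ψ) := by
  intro h
  rw [LinearMap.rTensor_sub, LinearMap.sub_apply, map_sub, hφ, hψ, LinearMap.sub_apply, sub_smul]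

theorem IsRightIntegralOn.smul {φ : Module.Dual k H} (hφ : IsRightIntegralOn φ) (c : k) :
    IsRightIntegralOn (c • φ) := by
  intro h
  rw [LinearMap.rTensor_smul, LinearMap.smul_apply, map_smul, hφ, LinearMap.smul_apply, smul_assoc]

theorem lid_rTensor_mul_one_tmul (φ : Module.Dual k H) (z : H ⊗[k] H) (a : H) :
    TensorProduct.lid k H (φ.rTensor H (z * (1 ⊗ₜ a))) =
      TensorProduct.lid k H (φ.rTensor H z) * a := by
  induction z with
  | zero => simp
  | add x y hx hy => simp only [add_mul, map_add, hx, hy]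
  | tmul u v => simp

theorem lid_rTensor_one_tmul_mul (φ : Module.Dual k H) (z : H ⊗[k] H) (a : H) :
    TensorProduct.lid k H (φ.rTensor H ((1 ⊗ₜ a) * z)) =
      a * TensorProduct.lid k H (φ.rTensor H z) := by
  induction z with
  | zero => simp
  | add x y hx hy => simp only [mul_add, map_add, hx, hy]
  | tmul u v => simp

theorem sum_comul_mul_one_tmul_antipode (a : H) :
    ∑ i ∈ (ℛ k a).index, comul (R := k) ((ℛ k a).left i) *
      (1 ⊗ₜ[k] antipode k ((ℛ k a).right i)) = a ⊗ₜ[k] 1 := by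
  set i₂ := Algebra.TensorProduct.includeRight (R := k) (A := H) (B := H)
  have h : toConv (comul : H →ₗ[k] H ⊗[k] H) * toConv (i₂.toLinearMap ∘ₗ antipode k) =
      toConv (Algebra.TensorProduct.includeLeft (R := k) (S := k) (A := H) (B := H)).toLinearMap := by
    rw [conv_comul, mul_assoc, conv_comp_id_mul_comp_antipode, mul_one]
  have h2 := congr($h a)
  rw [(ℛ k a).convMul_apply] at h2
  simpa [i₂] using h2

/-- For a right integral `t` of `H` and a right integral `φ` on `H`,
`∑ φ(t₁ a) t₂ = φ(t) S(a)`. -/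
theorem IsRightIntegralOn.lid_rTensor_comul_mul {t : H} (ht : IsRightIntegral k t)
    {φ : Module.Dual k H} (hφ : IsRightIntegralOn φ) (a : H) :
    TensorProduct.lid k H (φ.rTensor H (comul t * (a ⊗ₜ 1))) = φ t • antipode k a := by
  rw [← sum_comul_mul_one_tmul_antipode, Finset.mul_sum]
  simp_rw [← mul_assoc, ← Bialgebra.comul_mul, ht _, map_sum, lid_rTensor_mul_one_tmul, hφ _,
    map_smul, smul_assoc, smul_mul_assoc, one_mul, ← map_smul, ← map_sum]
  congr 1
  conv_rhs => rw [← sum_counit_smul (R := k) (ℛ k a), Finset.smul_sum]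
  exact Finset.sum_congr rfl fun _ _ => smul_comm _ _ _

/-- A normalized pair of a right integral in `H` and a nondegenerate right integral on `H`. -/
structure IsIntegralPair (t : H) (φ : Module.Dual k H) : Prop where
  left : IsRightIntegral k t
  right : IsRightIntegralOn φ
  apply_eq_one : φ t = 1
  eq_zero_of_mul_right : ∀ a, (∀ b, φ (a * b) = 0) → a = 0
  eq_zero_of_mul_left : ∀ a, (∀ b, φ (b * a) = 0) → a = 0
  antipode_injective : Function.Injective (antipode k (A := H))

variable (k H) in
theorem exists_isIntegralPair [FiniteDimensional k H] :
    ∃ (t : H) (φ : Module.Dual k H), IsIntegralPair t φ := by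
  obtain ⟨t, ht0, ht⟩ := exists_isLeftIntegral k H
  obtain ⟨hS, φ, n, x, y, h, hφ⟩ := ht.exists_isDualPair ht0
  have hr := ht.antipode hS.2
  have h0 : φ (antipode k t) ≠ 0 := by
    intro h0
    apply ht0
    apply hS.1
    rw [map_zero]
    refine h.eq_zero_of_mul_right fun b => ?_
    rw [hr, map_smul, h0, smul_zero]
  refine ⟨antipode k t, (φ (antipode k t))⁻¹ • φ, hr, hφ.smul _, by simp [h0], fun a ha => ?_,
    fun a ha => ?_, hS.1⟩
  · exact h.eq_zero_of_mul_right fun b => by simpa [h0] using ha b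
  · exact h.eq_zero_of_mul_left fun b => by simpa [h0] using ha b

namespace IsIntegralPair

variable {t : H} {φ : Module.Dual k H} (h : IsIntegralPair t φ)

include h

/-- The element `c = s - φ(s) t` is a right integral with `φ(c) = 0`, so `φ(c b) = ε(b) φ(c) = 0`
for all `b`, and nondegeneracy applies. -/
theorem eq_smul {s : H} (hs : IsRightIntegral k s) : s = φ s • t := by
  rw [← sub_eq_zero]
  refine h.eq_zero_of_mul_right _ fun b => ?_
  rw [sub_mul, smul_mul_assoc, hs, h.left, map_sub, map_smul, map_smul, map_smul, h.apply_eq_one]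
  simp [mul_comm]

theorem ne_zero : t ≠ 0 := by
  rintro rfl
  simpa using h.apply_eq_one

/-- The modular function attached to an integral pair. -/
noncomputable def modular : H →ₐ[k] k :=
  have hm : ∀ a : H, a * t = φ (a * t) • t := fun a => h.eq_smul fun b => by
    rw [mul_assoc, h.left, mul_smul_comm]
  AlgHom.ofLinearMap (φ ∘ₗ LinearMap.mulRight k t) (by simp [h.apply_eq_one]) fun a b => by
    simp only [LinearMap.comp_apply, LinearMap.mulRight_apply]
    rw [mul_assoc, hm b, mul_smul_comm, map_smul, smul_eq_mul, mul_comm]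
    simp [h.apply_eq_one]

theorem mul_eq_modular_smul (a : H) : a * t = h.modular a • t :=
  h.eq_smul fun b => by rw [mul_assoc, h.left, mul_smul_comm]

theorem isModularFunction_iff (m : H →ₐ[k] k) : IsModularFunction m ↔ m = h.modular := by
  refine ⟨?_, ?_⟩
  · rintro ⟨s, hs0, hs, hm⟩
    ext a
    have := hm a
    rw [h.eq_smul hs] at this hs0
    rw [mul_smul_comm, h.mul_eq_modular_smul, smul_comm] at this
    have := sub_eq_zero.mpr this
    rw [← sub_smul, smul_eq_zero, or_iff_left hs0, sub_eq_zero] at this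
    exact this.symm
  · rintro rfl
    exact ⟨t, h.ne_zero, h.left, h.mul_eq_modular_smul⟩

variable [FiniteDimensional k H]

theorem bijective_mul_left :
    Function.Bijective ((LinearMap.mul k H).flip.compr₂ φ) := by
  have : Function.Injective ((LinearMap.mul k H).flip.compr₂ φ) := by
    rw [← LinearMap.ker_eq_bot, LinearMap.ker_eq_bot']
    exact fun a ha => h.eq_zero_of_mul_left a fun b => congr($ha b)
  exact ⟨this, (LinearMap.injective_iff_surjective_of_finrank_eq_finrank
    Subspace.dual_finrank_eq.symm).mp this⟩

theorem bijective_mul_right :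
    Function.Bijective ((LinearMap.mul k H).compr₂ φ) := by
  have : Function.Injective ((LinearMap.mul k H).compr₂ φ) := by
    rw [← LinearMap.ker_eq_bot, LinearMap.ker_eq_bot']
    exact fun a ha => h.eq_zero_of_mul_right a fun b => congr($ha b)
  exact ⟨this, (LinearMap.injective_iff_surjective_of_finrank_eq_finrank
    Subspace.dual_finrank_eq.symm).mp this⟩

/-- The difference `u` is `φ(· w)` for some `w`, by nondegeneracy. As `u` is a right integral
vanishing at `t`, evaluating `∑ u(t₁) t₂ = ∑ φ(t₁ w) t₂` both ways gives `0 = S(w)`. -/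
theorem functional_eq_smul {ψ : Module.Dual k H} (hψ : IsRightIntegralOn ψ) : ψ = ψ t • φ := by
  rw [← sub_eq_zero]
  set u := ψ - ψ t • φ with hu
  have hut : u t = 0 := by simp [hu, h.apply_eq_one]
  obtain ⟨w, hw⟩ := h.bijective_mul_left.2 u
  have hw' : ∀ a, φ (a * w) = u a := fun a => congr($hw a)
  have h1 := (hψ.sub (h.right.smul (ψ t))).lid_rTensor_comul_mul h.left 1
  have h2 := h.right.lid_rTensor_comul_mul h.left w
  rw [← hu, hut, zero_smul] at h1
  rw [h.apply_eq_one, one_smul] at h2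
  have e : ∀ z : H ⊗[k] H, TensorProduct.lid k H (u.rTensor H (z * (1 ⊗ₜ 1))) =
      TensorProduct.lid k H (φ.rTensor H (z * (w ⊗ₜ 1))) := by
    intro z
    induction z with
    | zero => simp
    | add x y hx hy => simp only [add_mul, map_add, hx, hy]
    | tmul p q => simp [hw']
  rw [e, h2] at h1
  have hw0 : w = 0 := h.antipode_injective (by rw [h1, map_zero])
  rw [← hw, hw0, map_zero]

/-- The Nakayama automorphism attached to an integral pair. -/
noncomputable def nakayama : H ≃ₐ[k] H :=
  let e := (LinearEquiv.ofBijective _ h.bijective_mul_left).trans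
    (LinearEquiv.ofBijective _ h.bijective_mul_right).symm
  have he : ∀ a b, φ (a * b) = φ (e b * a) := fun a b => by
    have := (LinearEquiv.ofBijective _ h.bijective_mul_right).apply_symm_apply
      (LinearEquiv.ofBijective _ h.bijective_mul_left b)
    exact congr($this.symm a)
  have hz : ∀ a b, (∀ c, φ (a * c) = φ (b * c)) → a = b := fun a b hab => by
    rw [← sub_eq_zero]
    exact h.eq_zero_of_mul_right _ fun c => by rw [sub_mul, map_sub, hab, sub_self]
  AlgEquiv.ofLinearEquiv e
    (hz _ _ fun c => by rw [← he, mul_one, one_mul])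
    (fun a b => hz _ _ fun c => by
      rw [← he, ← mul_assoc, he (c * a) b, ← mul_assoc, he (e b * c) a, mul_assoc (e a)])

theorem map_mul_eq (a b : H) : φ (a * b) = φ (h.nakayama b * a) := by
  have := (LinearEquiv.ofBijective _ h.bijective_mul_right).apply_symm_apply
    (LinearEquiv.ofBijective _ h.bijective_mul_left b)
  exact congr($this.symm a)

theorem isNakayamaAutomorphism_iff (η : H ≃ₐ[k] H) :
    IsNakayamaAutomorphism η ↔ η = h.nakayama := by
  refine ⟨?_, ?_⟩
  · rintro ⟨ψ, hψ0, hψ, hη⟩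
    ext b
    rw [← sub_eq_zero]
    refine h.eq_zero_of_mul_right _ fun a => ?_
    have := hη a b
    rw [h.functional_eq_smul hψ] at this hψ0
    have hc : ψ t ≠ 0 := fun hc => hψ0 (by rw [hc, zero_smul])
    simp only [LinearMap.smul_apply, smul_eq_mul] at this
    rw [sub_mul, map_sub, ← h.map_mul_eq, mul_left_cancel₀ hc this, sub_self]
  · rintro rfl
    exact ⟨φ, fun h0 => by simpa [h0] using h.apply_eq_one, h.right, h.map_mul_eq⟩

/-- The square of the antipode in terms of the modular function and the Nakayama automorphism. -/
theorem antipode_antipode (a : H) :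
    antipode k (antipode k a) =
      TensorProduct.lid k H (h.modular.toLinearMap.rTensor H (comul (h.nakayama a))) := by
  let g : H →ₗ[k] H := (TensorProduct.lid k H).toLinearMap ∘ₗ φ.rTensor H ∘ₗ
    LinearMap.mulRight k (comul (R := k) t) ∘ₗ
    (Algebra.TensorProduct.includeLeft (R := k) (S := k) (A := H) (B := H)).toLinearMap
  have hg : ∀ b, g b = TensorProduct.lid k H (φ.rTensor H ((b ⊗ₜ 1) * comul t)) := fun b => rfl
  have h1 : antipode k a = g (h.nakayama a) := by
    have := h.right.lid_rTensor_comul_mul h.left a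
    rw [h.apply_eq_one, one_smul] at this
    rw [← this, hg]
    induction comul (R := k) t with
    | zero => simp
    | add x y hx hy => simp only [mul_add, add_mul, map_add, hx, hy]
    | tmul p q => simp [h.map_mul_eq p a]
  -- Here `g(b) = ∑ φ(b t₁) t₂`. Contracting `Δ(b t) = m(b) Δ(t)` with `φ` gives `∑ b₂ g(b₁) = m(b)
  -- 1`; applying `S` and cancelling `S(b₂)` by convolution yields `S(g(b)) = ∑ m(b₁) b₂`.
  have h2 : ∀ b, ∑ i ∈ (ℛ k b).index, (ℛ k b).right i * g ((ℛ k b).left i) =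
      h.modular b • (1 : H) := by
    intro b
    have e : TensorProduct.lid k H (φ.rTensor H (comul (b * t))) = h.modular b • (1 : H) := by
      rw [h.mul_eq_modular_smul, h.right, map_smul, h.apply_eq_one, smul_eq_mul, mul_one]
    rw [← e, Bialgebra.comul_mul, ← (ℛ k b).eq, Finset.sum_mul, map_sum, map_sum]
    refine Finset.sum_congr rfl fun i _ => ?_
    rw [hg, ← lid_rTensor_one_tmul_mul, ← mul_assoc]
    simp
  have h3 : toConv (antipode k ∘ₗ g) * toConv (antipode k) =
      toConv (Algebra.linearMap k H ∘ₗ h.modular.toLinearMap) := by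
    ext b
    rw [(ℛ k b).convMul_apply]
    have := congr(antipode k $(h2 b))
    simpa [antipode_mul_antidistrib, Algebra.algebraMap_eq_smul_one] using this
  have h4 : toConv (antipode k ∘ₗ g) =
      toConv (Algebra.linearMap k H ∘ₗ h.modular.toLinearMap) * toConv LinearMap.id := by
    rw [← h3, mul_assoc, LinearMap.antipode_mul_id, mul_one]
  rw [h1]
  have := congr($h4 (h.nakayama a))
  rw [(ℛ k _).convMul_apply] at this
  rw [← (ℛ k (h.nakayama a)).eq]
  simpa [Algebra.algebraMap_eq_smul_one] using this

end IsIntegralPair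

end Modular

/-! ### Modules maximizing `dim Hom_R(V, H) / dim V` -/

section HomDim

universe u

variable {k R : Type*} {H : Type u} [Field k] [Ring R] [Algebra k R] [Ring H] [Algebra k H]
  [Module R H] [IsScalarTower k R H]

instance finite_submodule_of_isScalarTower (V : Type*) [AddCommGroup V]
    [Module k V] [Module R V] [IsScalarTower k R V] [FiniteDimensional k V] (W : Submodule R V) :
    FiniteDimensional k W :=
  Module.Finite.of_injective (W.subtype.restrictScalars k) Subtype.val_injective

instance finite_linearMap_of_isScalarTower [FiniteDimensional k H] (V : Type*) [AddCommGroup V]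
    [Module k V] [Module R V] [IsScalarTower k R V] [FiniteDimensional k V] :
    FiniteDimensional k (V →ₗ[R] H) :=
  Module.Finite.of_injective (LinearMap.restrictScalarsₗ k R V H k)
    (LinearMap.restrictScalars_injective k)

variable (k R H) in
/-- The dimension of `Hom_R(V, H)`. -/
noncomputable def homDim (V : Type*) [AddCommGroup V] [Module k V] [Module R V]
    [IsScalarTower k R V] : ℕ :=
  Module.finrank k (V →ₗ[R] H)

variable [FiniteDimensional k H]

section Restrict

variable {V : Type*} [AddCommGroup V] [Module k V] [Module R V] [IsScalarTower k R V]
  [FiniteDimensional k V]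

variable (k H) in
/-- Restriction of `R`-linear maps into `H` to a submodule. -/
def restrictHom (W : Submodule R V) : (V →ₗ[R] H) →ₗ[k] (W →ₗ[R] H) where
  toFun G := G ∘ₗ W.subtype
  map_add' _ _ := rfl
  map_smul' _ _ := rfl

theorem homDim_le (W : Submodule R V) :
    homDim k R H V ≤ Module.finrank k (LinearMap.range (restrictHom k H W)) +
      homDim k R H (V ⧸ W) := by
  rw [homDim, ← LinearMap.finrank_range_add_finrank_ker (restrictHom k H W)]
  gcongr
  let c : ((V ⧸ W) →ₗ[R] H) →ₗ[k] (V →ₗ[R] H) :=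
    { toFun G := G ∘ₗ W.mkQ
      map_add' _ _ := rfl
      map_smul' _ _ := rfl }
  refine (Submodule.finrank_mono (t := LinearMap.range c) ?_).trans (LinearMap.finrank_range_le c)
  intro G hG
  have hG' : ∀ x ∈ W, G x = 0 := fun x hx => congr($(LinearMap.mem_ker.mp hG) ⟨x, hx⟩)
  exact ⟨W.liftQ G fun x hx => hG' x hx, LinearMap.ext fun _ => rfl⟩

theorem homDim_le_mul : homDim k R H V ≤ Module.finrank k V * Module.finrank k H := by
  rw [← Module.finrank_linearMap (R := k) (S := k)]
  exact LinearMap.finrank_le_finrank_of_injective (f := LinearMap.restrictScalarsₗ k R V H k)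
    (LinearMap.restrictScalars_injective k)

theorem finrank_submodule_add_quotient (W : Submodule R V) :
    Module.finrank k (V ⧸ W) + Module.finrank k W = Module.finrank k V :=
  Submodule.finrank_quotient_add_finrank (W.restrictScalars k)

end Restrict

variable (k R H) in
/-- The ratio `dim Hom_R(V, H) / dim V` is maximal for `V` among all nonzero `R`-modules of finite
dimension. -/
def IsMaxRatio (V : Type u) [AddCommGroup V] [Module k V] [Module R V] [IsScalarTower k R V] :
    Prop :=
  ∀ (U : Type u) [AddCommGroup U] [Module k U] [Module R U] [IsScalarTower k R U]
    [FiniteDimensional k U],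
    homDim k R H U * Module.finrank k V ≤ homDim k R H V * Module.finrank k U

/-- A bound for modules of dimension at most `dim R` covers cyclic modules. It spreads to all
modules by splitting off a cyclic submodule, because `dim Hom_R(-, H)` is subadditive. -/
theorem isMaxRatio_of_le [FiniteDimensional k R] {n d : ℕ}
    (hmax : ∀ (U : Type u) [AddCommGroup U] [Module k U] [Module R U] [IsScalarTower k R U]
      [FiniteDimensional k U], Module.finrank k U ≤ Module.finrank k R →
      homDim k R H U * d ≤ n * Module.finrank k U)
    (N : ℕ) (U : Type u) [AddCommGroup U] [Module k U] [Module R U] [IsScalarTower k R U]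
    [FiniteDimensional k U] (hU : Module.finrank k U = N) :
    homDim k R H U * d ≤ n * Module.finrank k U := by
  induction N using Nat.strong_induction_on generalizing U with
  | _ N ih =>
    rcases Nat.eq_zero_or_pos N with h0 | hpos
    · have : homDim k R H U ≤ _ := homDim_le_mul
      rw [hU, h0, zero_mul, Nat.le_zero] at this
      simp [this]
    · have hnt : Nontrivial U := Module.nontrivial_of_finrank_pos (R := k) (by omega)
      obtain ⟨v, hv⟩ := exists_ne (0 : U)
      set W := Submodule.span R {v} with hW
      have hvW : v ∈ W := Submodule.mem_span_singleton_self v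
      have hdW : Module.finrank k W ≤ Module.finrank k R := by
        let f : R →ₗ[k] W :=
          (LinearMap.codRestrict W (LinearMap.toSpanSingleton R U v)
            fun r => W.smul_mem r hvW).restrictScalars k
        refine LinearMap.finrank_le_finrank_of_surjective (f := f) ?_
        rintro ⟨x, hx⟩
        obtain ⟨r, rfl⟩ := Submodule.mem_span_singleton.mp hx
        exact ⟨r, rfl⟩
      have hW0 : 0 < Module.finrank k W := by
        have : Nontrivial W := ⟨⟨v, hvW⟩, 0, fun h => hv congr(($h : U))⟩
        exact Module.finrank_pos
      have hadd := finrank_submodule_add_quotient (k := k) W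
      have h1 := hmax W hdW
      have h2 := ih (Module.finrank k (U ⧸ W)) (by omega) (U ⧸ W) rfl
      have h3 := homDim_le (k := k) (H := H) W
      have h4 := Submodule.finrank_le (LinearMap.range (restrictHom k H W))
      change _ ≤ homDim k R H W at h4
      calc homDim k R H U * d ≤ (homDim k R H W + homDim k R H (U ⧸ W)) * d := by gcongr; omega
        _ ≤ n * Module.finrank k W + n * Module.finrank k (U ⧸ W) := by rw [add_mul]; gcongr
        _ = n * Module.finrank k U := by rw [← hadd]; ring

variable (k R H) in
theorem exists_isMaxRatio [FiniteDimensional k R] [Nontrivial H] :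
    ∃ (V : Type u) (_ : AddCommGroup V) (_ : Module k V) (_ : Module R V)
      (_ : IsScalarTower k R V) (_ : FiniteDimensional k V),
      0 < Module.finrank k V ∧ 0 < homDim k R H V ∧ IsMaxRatio k R H V := by
  -- Large enough for the cyclic modules, to which the maximum reduces, and for `H` itself, whose
  -- identity map makes the maximal ratio positive.
  let N := Module.finrank k R + Module.finrank k H
  let S : Set (ℕ × ℕ) := {p | ∃ (V : Type u) (_ : AddCommGroup V) (_ : Module k V) (_ : Module R V)
      (_ : IsScalarTower k R V) (_ : FiniteDimensional k V),
      0 < Module.finrank k V ∧ Module.finrank k V ≤ N ∧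
      p = (homDim k R H V, Module.finrank k V)}
  have hH : (homDim k R H H, Module.finrank k H) ∈ S :=
    ⟨H, _, _, _, ‹_›, ‹_›, Module.finrank_pos, Nat.le_add_left _ _, rfl⟩
  have hfin : S.Finite := by
    refine (Set.finite_Iic (N * Module.finrank k H, N)).subset ?_
    rintro _ ⟨V, _, _, _, _, _, h0, hN, rfl⟩
    refine ⟨?_, hN⟩
    exact homDim_le_mul.trans (Nat.mul_le_mul_right _ hN)
  obtain ⟨_, ⟨V, i1, i2, i3, i4, i5, h0, hN, rfl⟩, hmax⟩ :=
    Set.exists_max_image S (fun p => (p.1 : ℚ) / p.2) hfin ⟨_, hH⟩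
  have hmax' : ∀ (U : Type u) [AddCommGroup U] [Module k U] [Module R U] [IsScalarTower k R U]
      [FiniteDimensional k U], 0 < Module.finrank k U → Module.finrank k U ≤ N →
      homDim k R H U * Module.finrank k V ≤ homDim k R H V * Module.finrank k U := by
    intro U _ _ _ _ _ hU0 hUN
    have := hmax _ ⟨U, _, _, _, ‹_›, ‹_›, hU0, hUN, rfl⟩
    simp only at this
    rw [div_le_div_iff₀ (by exact_mod_cast hU0) (by exact_mod_cast h0)] at this
    exact_mod_cast this
  refine ⟨V, i1, i2, i3, i4, i5, h0, ?_, ?_⟩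
  · have h1 := hmax' H Module.finrank_pos (Nat.le_add_left _ _)
    have h2 : 0 < homDim k R H H := by
      have : Nontrivial (H →ₗ[R] H) := ⟨LinearMap.id, 0, fun h => by
        obtain ⟨x, hx⟩ := exists_ne (0 : H)
        exact hx congr($h x)⟩
      exact Module.finrank_pos
    by_contra h3
    have h4 := Nat.mul_pos h2 h0
    simp only [Nat.not_lt, Nat.le_zero] at h3
    rw [h3] at h1
    omega
  · intro U _ _ _ _ _
    refine isMaxRatio_of_le (fun U _ _ _ _ _ hU => ?_) _ U rfl
    rcases Nat.eq_zero_or_pos (Module.finrank k U) with h | h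
    · have h1 : homDim k R H U ≤ _ := homDim_le_mul
      rw [h, zero_mul, Nat.le_zero] at h1
      simp [h1]
    · exact hmax' U h (hU.trans (Nat.le_add_right _ _))

/-- For a module `M` with maximal ratio, `R`-linear maps to `H` extend from submodules to `M`. -/
theorem IsMaxRatio.surjective_restrictHom {M : Type u} [AddCommGroup M] [Module k M] [Module R M]
    [IsScalarTower k R M] [FiniteDimensional k M] (hM : IsMaxRatio k R H M)
    (hM0 : 0 < Module.finrank k M) (K : Submodule R M) :
    Function.Surjective (restrictHom k H K) := by
  rw [← LinearMap.range_eq_top]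
  apply Submodule.eq_top_of_finrank_eq
  refine le_antisymm (Submodule.finrank_le _) ?_
  change homDim k R H K ≤ _
  -- The quotient `M ⧸ K` has at most the ratio of `M`. By subadditivity the image of restriction
  -- then has dimension at least that ratio times `dim K`, which bounds `dim Hom_R(K, H)` because
  -- `K` has at most this ratio too.
  have h1 := homDim_le (k := k) (H := H) K
  have h2 := hM K
  have h3 := hM (M ⧸ K)
  have h4 := finrank_submodule_add_quotient (k := k) K
  refine Nat.le_of_mul_le_mul_right ?_ hM0
  have h5 := Nat.mul_le_mul_right (Module.finrank k M) h1
  have h6 : homDim k R H M * Module.finrank k M = homDim k R H M * Module.finrank k (M ⧸ K) +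
      homDim k R H M * Module.finrank k K := by rw [← h4]; ring
  rw [add_mul] at h5
  omega

end HomDim

/-! ### Homomorphisms from the diagonal tensor product `V ⊗ H` -/

section DiagTensor

universe u

variable {k R : Type*} {H : Type u} [Field k] [Ring R] [HopfAlgebra k R] [Ring H]
  [HopfAlgebra k H]

theorem tensorDualEquivEnd_twist [FiniteDimensional k H] (g a : H) (f : Module.Dual k H) :
    tensorDualEquivEnd k H (twist (contragredient k H) LinearMap.id (g ⊗ₜ f)) a =
      TensorProduct.rid k H (LinearMap.lTensor H f
        (twist (Algebra.lmul k H) (antipode k) (g ⊗ₜ a))) := by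
  rw [twist_tmul_repr _ _ _ _ (ℛ k g), twist_tmul_repr _ _ _ _ (ℛ k g)]
  simp [tensorDualEquivEnd_tmul, contragredient_apply]

theorem rid_lTensor_rTensor_mulLeft {W : Type*} [AddCommGroup W] [Module k W] (a : H)
    (f : Module.Dual k W) (z : H ⊗[k] W) :
    TensorProduct.rid k H (LinearMap.lTensor H f
      (LinearMap.rTensor W (LinearMap.mulLeft k a) z)) =
      a * TensorProduct.rid k H (LinearMap.lTensor H f z) := by
  induction z with
  | zero => simp
  | add x y hx hy => simp only [mul_add, map_add, hx, hy]
  | tmul u v => simp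

variable [Module R H] [IsScalarTower k R H]
  {V : Type*} [AddCommGroup V] [Module k V] [Module R V] [IsScalarTower k R V]

theorem rTensor_diag (ι : R →ₐc[k] H) (hι : ∀ (r : R) (x : H), r • x = ι r * x)
    (G : V →ₗ[R] H) (r : R) (z : V ⊗[k] H) :
    LinearMap.rTensor H (G.restrictScalars k)
      (diag (Algebra.lsmul k k V) (Algebra.lsmul k k H) r z) =
      diag (Algebra.lmul k H) (Algebra.lmul k H) (ι r)
        (LinearMap.rTensor H (G.restrictScalars k) z) := by
  have hr : ∑ i ∈ (ℛ k r).index, ι ((ℛ k r).left i) ⊗ₜ[k] ι ((ℛ k r).right i) =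
      comul (R := k) (ι r) := by
    rw [← CoalgHomClass.map_comp_comul_apply, ← (ℛ k r).eq]
    simp
  rw [diag_repr _ _ r (ℛ k r), diag_repr _ _ (ι r) ⟨_, _, _, hr⟩]
  induction z with
  | zero => simp
  | add x y hx hy => simp only [map_add, hx, hy]
  | tmul u v => simp [hι]

variable {M : Type*} [AddCommGroup M] [Module k M] [Module R M] [IsScalarTower k R M]

/-- The `R`-linear map `v ⊗ a ↦ ∑ G(v)₁ f(S(G(v)₂) a)` from the diagonal tensor product `V ⊗ H`
to `H`. -/
noncomputable def diagHom (ι : R →ₐc[k] H) (hι : ∀ (r : R) (x : H), r • x = ι r * x)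
    (e : M ≃ₗ[k] V ⊗[k] H)
    (he : ∀ (r : R) (m : M),
      e (r • m) = diag (Algebra.lsmul k k V) (Algebra.lsmul k k H) r (e m))
    (f : Module.Dual k H) : (V →ₗ[R] H) →ₗ[k] (M →ₗ[R] H) where
  toFun G :=
    { toFun m := TensorProduct.rid k H (LinearMap.lTensor H f
        (twist (Algebra.lmul k H) (antipode k) (LinearMap.rTensor H (G.restrictScalars k) (e m))))
      map_add' _ _ := by simp only [map_add]
      map_smul' r m := by
        rw [he, rTensor_diag ι hι, twist_antipode_diag, rid_lTensor_rTensor_mulLeft,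
          RingHom.id_apply, hι] }
  map_add' G G' := by
    ext m
    have : (G + G').restrictScalars k = G.restrictScalars k + G'.restrictScalars k := rfl
    simp [this, LinearMap.rTensor_add]
  map_smul' c G := by
    ext m
    have : (c • G).restrictScalars k = c • G.restrictScalars k := rfl
    simp [this, LinearMap.rTensor_smul]

omit [IsScalarTower k R M] in
theorem diagHom_apply (ι : R →ₐc[k] H) (hι : ∀ (r : R) (x : H), r • x = ι r * x)
    (e : M ≃ₗ[k] V ⊗[k] H)
    (he : ∀ (r : R) (m : M),
      e (r • m) = diag (Algebra.lsmul k k V) (Algebra.lsmul k k H) r (e m))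
    (f : Module.Dual k H) (G : V →ₗ[R] H) (m : M) :
    diagHom ι hι e he f G m = TensorProduct.rid k H (LinearMap.lTensor H f
      (twist (Algebra.lmul k H) (antipode k)
        (LinearMap.rTensor H (G.restrictScalars k) (e m)))) := rfl

/-- The maps `diagHom` attached to `G` and to the coordinate functionals `f` are jointly injective:
under `H ⊗ H* ≃ End H` their values at `v ⊗ a` come from the twist of `∑ G(v) ⊗ f`, and the twist is
invertible. -/
theorem homDim_mul_le [FiniteDimensional k H] [FiniteDimensional k V] [FiniteDimensional k M]
    (ι : R →ₐc[k] H) (hι : ∀ (r : R) (x : H), r • x = ι r * x)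
    (e : M ≃ₗ[k] V ⊗[k] H)
    (he : ∀ (r : R) (m : M),
      e (r • m) = diag (Algebra.lsmul k k V) (Algebra.lsmul k k H) r (e m)) :
    homDim k R H V * Module.finrank k H ≤ homDim k R H M := by
  classical
  let b := Module.finBasis k H
  let Φ : (Fin (Module.finrank k H) → (V →ₗ[R] H)) →ₗ[k] (M →ₗ[R] H) :=
    ∑ i, diagHom ι hι e he (b.coord i) ∘ₗ LinearMap.proj i
  have hΦ : Function.Injective Φ := by
    rw [← LinearMap.ker_eq_bot, LinearMap.ker_eq_bot']
    intro G hG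
    ext j v
    let Z : H ⊗[k] Module.Dual k H := ∑ i, G i v ⊗ₜ b.coord i
    have h1 : twist (contragredient k H) LinearMap.id Z = 0 := by
      apply (tensorDualEquivEnd k H).injective
      ext a
      have := congr($hG (e.symm (v ⊗ₜ a)))
      simp only [Φ, LinearMap.sum_apply, LinearMap.comp_apply, LinearMap.proj_apply,
        diagHom_apply, LinearEquiv.apply_symm_apply, LinearMap.rTensor_tmul,
        LinearMap.zero_apply] at this
      simp only [Z, map_sum, LinearMap.sum_apply, tensorDualEquivEnd_twist, map_zero,
        LinearMap.zero_apply]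
      exact this
    have h2 : Z = 0 := by
      rw [← twist_antipode_twist_id (contragredient k H) Z, h1, map_zero]
    have := congr(tensorDualEquivEnd k H $h2 (b j))
    simpa [Z, tensorDualEquivEnd_tmul, Finsupp.single_apply] using this
  have := LinearMap.finrank_le_finrank_of_injective hΦ
  rwa [Module.finrank_pi_fintype, Finset.sum_const, Finset.card_univ, Fintype.card_fin,
    smul_eq_mul, mul_comm] at this

end DiagTensor

/-! ### Integrals of `H` as multiples of integrals of `R` -/

section Key

universe u

/-- The underlying space of the diagonal tensor product of two modules over a Hopf algebra. -/
def DiagTensor (k V W : Type*) [Field k] [AddCommGroup V] [AddCommGroup W] [Module k V]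
    [Module k W] : Type _ :=
  V ⊗[k] W

noncomputable instance (k V W : Type*) [Field k] [AddCommGroup V] [AddCommGroup W] [Module k V]
    [Module k W] : AddCommGroup (DiagTensor k V W) :=
  inferInstanceAs (AddCommGroup (V ⊗[k] W))

noncomputable instance (k V W : Type*) [Field k] [AddCommGroup V] [AddCommGroup W] [Module k V]
    [Module k W] : Module k (DiagTensor k V W) :=
  inferInstanceAs (Module k (V ⊗[k] W))

variable {k R : Type*} {H : Type u} [Field k] [Ring R] [HopfAlgebra k R] [Ring H]
  [HopfAlgebra k H] [FiniteDimensional k R] [FiniteDimensional k H]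

/-- If `V` has maximal ratio, so has `V ⊗ H`, hence maps into `H` extend from its submodules. Both
`z = l (v ⊗ 1)` and `t` transform under `R` by `ε`, so `z ↦ t` extends to an `R`-linear `E`, and `t
= E(l m) = l E(m)`. -/
theorem exists_mul_eq_of_module [Module R H] [IsScalarTower k R H] (ι : R →ₐc[k] H)
    (hinj : Function.Injective ι) (hι : ∀ (r : R) (x : H), r • x = ι r * x)
    {l : R} (hl0 : l ≠ 0) (hl : IsLeftIntegral k l) {t : H} (ht : IsLeftIntegral k t) :
    ∃ y, t = ι l * y := by
  have := nontrivial_of_hopfAlgebra k H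
  obtain ⟨V, _, _, _, _, _, hV0, hV1, hV⟩ := exists_isMaxRatio k R H
  let e : DiagTensor k V H ≃ₗ[k] V ⊗[k] H := LinearEquiv.refl k (V ⊗[k] H)
  let δ := diag (k := k) (B := R) (Algebra.lsmul k k V) (Algebra.lsmul k k H)
  let _ : Module R (DiagTensor k V H) := Module.compHom (V ⊗[k] H) δ.toRingHom
  have he : ∀ (r : R) (m : DiagTensor k V H), e (r • m) = δ r (e m) := fun _ _ => rfl
  have : IsScalarTower k R (DiagTensor k V H) := ⟨fun c r m => by
    apply e.injective
    rw [he, map_smul, map_smul, LinearMap.smul_apply, he]⟩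
  have : FiniteDimensional k (DiagTensor k V H) := Module.Finite.equiv e.symm
  have hdim : Module.finrank k (DiagTensor k V H) =
      Module.finrank k V * Module.finrank k H := by
    rw [e.finrank_eq, Module.finrank_tensorProduct]
  have hM0 : 0 < Module.finrank k (DiagTensor k V H) := by
    rw [hdim]
    exact Nat.mul_pos hV0 Module.finrank_pos
  have hM : IsMaxRatio k R H (DiagTensor k V H) := by
    intro U _ _ _ _ _
    have h1 := hV U
    have h2 := homDim_mul_le ι hι e he
    calc homDim k R H U * Module.finrank k (DiagTensor k V H)
        = (homDim k R H U * Module.finrank k V) * Module.finrank k H := by rw [hdim, mul_assoc]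
      _ ≤ (homDim k R H V * Module.finrank k U) * Module.finrank k H := by gcongr
      _ = (homDim k R H V * Module.finrank k H) * Module.finrank k U := by ring
      _ ≤ _ := by gcongr
  obtain ⟨G, v, hGv⟩ : ∃ (G : V →ₗ[R] H) (v : V), G v ≠ 0 := by
    by_contra! h
    have : Subsingleton (V →ₗ[R] H) :=
      ⟨fun G G' => LinearMap.ext fun v => by rw [h, h]⟩
    have : homDim k R H V = 0 := Module.finrank_zero_of_subsingleton
    omega
  set m : DiagTensor k V H := e.symm (v ⊗ₜ 1) with hm
  set z := l • m with hz
  -- Apply `G ⊗ φ S p` to `z = ∑ l₁ v ⊗ ι(l₂)`, where `p` is a linear retraction of `ι`. The dual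
  -- basis identity at `1` gives back `G(v) ≠ 0`.
  have hz0 : z ≠ 0 := by
    intro h0
    obtain ⟨-, φ, n, x, y, hd, -⟩ := hl.exists_isDualPair hl0
    obtain ⟨p, hp⟩ := LinearMap.exists_leftInverse_of_injective (ι : R →ₗ[k] H)
      (LinearMap.ker_eq_bot.mpr hinj)
    have h1 : e z = ∑ i, (x i • v) ⊗ₜ ι (y i) := by
      rw [hz, he, hm, LinearEquiv.apply_symm_apply]
      have := diag_repr (k := k) (Algebra.lsmul k k V) (Algebra.lsmul k k H) l
        ⟨Finset.univ, x, y, hd.comul_eq.symm⟩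
      simp only [δ, this, LinearMap.sum_apply, TensorProduct.map_tmul, Algebra.lsmul_coe, hι,
        mul_one]
    have h2 := congr(TensorProduct.rid k H (TensorProduct.map (G.restrictScalars k)
      (φ ∘ₗ antipode k ∘ₗ p) $h1))
    have hp' : ∀ r, p (ι r) = r := fun r => congr($hp r)
    have h3 := congr(ι $(hd.sum_smul 1))
    simp only [h0, map_zero, map_sum, TensorProduct.map_tmul, LinearMap.comp_apply, hp',
      TensorProduct.rid_tmul, LinearMap.restrictScalars_apply, map_smul, hι] at h2
    simp only [mul_one, map_sum, map_smul, map_one] at h3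
    simp_rw [← smul_mul_assoc, ← Finset.sum_mul, h3, one_mul] at h2
    exact hGv h2.symm
  have hrz : ∀ r : R, r • z = counit (R := k) r • z := fun r => by
    rw [hz, ← mul_smul, hl, smul_assoc]
  obtain ⟨ξ, hξ⟩ : ∃ ξ : Module.Dual k (DiagTensor k V H), ξ z = 1 := by
    obtain ⟨g, hg⟩ : ∃ g : Module.Dual k (DiagTensor k V H), g z ≠ 0 := by
      by_contra! h
      exact hz0 ((Module.forall_dual_apply_eq_zero_iff k z).mp h)
    exact ⟨(g z)⁻¹ • g, by simp [hg]⟩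
  let K := Submodule.span R {z}
  let F : K →ₗ[R] H :=
    { toFun x := ξ x.1 • t
      map_add' x y := by simp [add_smul]
      map_smul' r x := by
        obtain ⟨x, hx⟩ := x
        obtain ⟨s, rfl⟩ := Submodule.mem_span_singleton.mp hx
        simp only [SetLike.mk_smul_mk, RingHom.id_apply]
        rw [← mul_smul, hrz, hrz, hι, mul_smul_comm, ht, Bialgebra.counit_mul]
        simp [hξ, smul_smul, mul_comm] }
  obtain ⟨E, hE⟩ := hM.surjective_restrictHom hM0 K F
  refine ⟨E m, ?_⟩
  have h1 : E z = t := by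
    have := congr($hE ⟨z, Submodule.mem_span_singleton_self z⟩)
    change E z = ξ z • t at this
    rwa [hξ, one_smul] at this
  rw [← h1, hz, map_smul, hι]

/-- If `R` is a Hopf subalgebra of `H`, every left integral of `H` is a right multiple of any
nonzero left integral of `R`. -/
theorem IsLeftIntegral.exists_map_mul_eq (ι : R →ₐc[k] H) (hinj : Function.Injective ι)
    {l : R} (hl0 : l ≠ 0) (hl : IsLeftIntegral k l) {t : H} (ht : IsLeftIntegral k t) :
    ∃ y, t = ι l * y := by
  let _ : Module R H := Module.compHom H (ι : R →+* H)
  have hι : ∀ (r : R) (x : H), r • x = ι r * x := fun _ _ => rfl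
  have : IsScalarTower k R H := ⟨fun c r x => by simp [hι]⟩
  exact exists_mul_eq_of_module ι hinj hι hl0 hl ht

/-- If `R` is a Hopf subalgebra of `H` and `l` is a nonzero left integral of `R`, then `h l = 0`
implies `ε(h) = 0`. -/
theorem IsLeftIntegral.counit_eq_zero_of_mul_eq_zero (ι : R →ₐc[k] H)
    (hinj : Function.Injective ι) {l : R} (hl0 : l ≠ 0) (hl : IsLeftIntegral k l) {h : H}
    (hh : h * ι l = 0) : counit (R := k) h = 0 := by
  obtain ⟨t, ht0, ht⟩ := exists_isLeftIntegral k H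
  obtain ⟨y, rfl⟩ := hl.exists_map_mul_eq ι hinj hl0 ht
  have := ht h
  rw [← mul_assoc, hh, zero_mul, eq_comm, smul_eq_zero] at this
  exact this.resolve_right ht0

end Key

/-! ### Consequences of semisimplicity for integrals -/

section Semisimple

variable {k R H : Type*} [Field k] [Ring R] [HopfAlgebra k R] [Ring H] [HopfAlgebra k H]

variable (k H) in
/-- The right submodule of right integrals of `H`. -/
def rightIntegrals : Submodule Hᵐᵒᵖ H where
  carrier := {x | IsRightIntegral k x}
  add_mem' {x y} hx hy h := by rw [add_mul, hx, hy, smul_add]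
  zero_mem' h := by simp
  smul_mem' a x hx h := by
    rw [MulOpposite.smul_eq_mul_unop, hx, smul_mul_assoc, hx, smul_comm]

variable (k H) in
/-- The left submodule of left integrals of `H`. -/
def leftIntegrals : Submodule H H where
  carrier := {x | IsLeftIntegral k x}
  add_mem' {x y} hx hy h := by rw [mul_add, hx, hy, smul_add]
  zero_mem' h := by simp
  smul_mem' a x hx h := by
    rw [smul_eq_mul, hx, mul_smul_comm, hx, smul_comm]

variable [FiniteDimensional k H]

/-- The hypothesis is applied to the module of right integrals, on which `H` acts by `ε`. The
embedding produces an invariant in the induced module, the splitting normalizes its counit, and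
multiplication by `t` carries it to an invariant in `H`. -/
theorem exists_of_isRightSemisimpleExtension (ι : R →ₐc[k] H)
    (hss : RingExt.IsRightSemisimpleExtension (ι : R →+* H)) {t : R} (ht : IsRightIntegral k t) :
    ∃ s : H, counit (R := k) s = 1 ∧ IsRightIntegral k (ι t * s) := by
  obtain ⟨n₀, ξ, hn⟩ := exists_isIntegralPair k H
  obtain ⟨i, p, hpi⟩ := hss (rightIntegrals k H)
  let J := (Submodule.span Hᵐᵒᵖ
    {x : H ⊗[ℤ] (rightIntegrals k H) | ∃ (b : R) (a : H) (n : rightIntegrals k H),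
      x = ((ι : R →+* H) b * a) ⊗ₜ[ℤ] n - a ⊗ₜ[ℤ] (MulOpposite.op ((ι : R →+* H) b) • n)})
  let q : H ⊗[ℤ] (rightIntegrals k H) →ₗ[Hᵐᵒᵖ]
    RingExt.InducedRight (ι : R →+* H) (rightIntegrals k H) := J.mkQ
  let f : rightIntegrals k H →+ k :=
    { toFun n := ξ (p (q (1 ⊗ₜ n)) : H)
      map_zero' := by simp
      map_add' x y := by simp [TensorProduct.tmul_add] }
  have hpq : ∀ (a : H) (n : rightIntegrals k H),
      (p (q (a ⊗ₜ n)) : H) = counit (R := k) a • (p (q (1 ⊗ₜ n)) : H) := by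
    intro a n
    have : a ⊗ₜ[ℤ] n = MulOpposite.op a • ((1 : H) ⊗ₜ[ℤ] n) := by
      rw [TensorProduct.smul_tmul', MulOpposite.smul_eq_mul_unop, one_mul,
        MulOpposite.unop_op]
    rw [this, map_smul, map_smul]
    exact (p (q (1 ⊗ₜ n))).2 a
  have hf : ∀ (b : R) (n : rightIntegrals k H),
      f (MulOpposite.op (ι b) • n) = counit (R := k) b * f n := by
    intro b n
    have : q ((ι b) ⊗ₜ n) = q (1 ⊗ₜ (MulOpposite.op (ι b) • n)) := by
      rw [← sub_eq_zero, ← map_sub]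
      refine (Submodule.Quotient.mk_eq_zero _).mpr (Submodule.subset_span ⟨b, 1, n, ?_⟩)
      rw [mul_one]
      rfl
    change ξ (p (q (1 ⊗ₜ _)) : H) = _ * ξ (p (q (1 ⊗ₜ n)) : H)
    rw [← this, hpq, map_smul, smul_eq_mul, CoalgHomClass.counit_comp_apply]
  -- `F` need not descend to the induced module, as it sends `b a ⊗ n` and `a ⊗ n b` to `f(n) b a`
  -- and `ε(b) f(n) a`. Left multiplication by `ι t` removes the difference.
  let F : H ⊗[ℤ] (rightIntegrals k H) →ₗ[Hᵐᵒᵖ] H := TensorProduct.AlgebraTensorModule.lift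
    { toFun a :=
        { toFun n := f n • a
          map_add' := by simp [add_smul]
          map_smul' m n := by rw [map_zsmul, smul_assoc, RingHom.id_apply] }
      map_add' a b := by ext; simp
      map_smul' c a := by ext; simp }
  have hF : ∀ a n, F (a ⊗ₜ n) = f n • a := fun a n => rfl
  have hεF : ∀ z, counit (R := k) (F z) = ξ (p (q z) : H) := by
    intro z
    induction z with
    | zero => simp
    | add x y hx hy => simp only [map_add, hx, hy, Submodule.coe_add]
    | tmul a n =>
      rw [hpq, hF, map_smul, map_smul, smul_eq_mul, smul_eq_mul, mul_comm]
      rfl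
  let G : H ⊗[ℤ] (rightIntegrals k H) →ₗ[Hᵐᵒᵖ] H :=
    { toFun z := ι t * F z
      map_add' := by simp [mul_add]
      map_smul' c z := by simp [MulOpposite.smul_eq_mul_unop, mul_assoc] }
  have hG : J ≤ LinearMap.ker G := by
    refine Submodule.span_le.mpr ?_
    rintro _ ⟨b, a, n, rfl⟩
    rw [SetLike.mem_coe, LinearMap.mem_ker, map_sub, sub_eq_zero]
    change ι t * F (((ι b) * a) ⊗ₜ n) = ι t * F (a ⊗ₜ (MulOpposite.op (ι b) • n))
    rw [hF, hF, hf, mul_smul_comm, ← mul_assoc, ← map_mul, ht, map_smul, smul_mul_assoc, smul_smul,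
      mul_smul_comm, mul_comm]
  let g : RingExt.InducedRight (ι : R →+* H) (rightIntegrals k H) →ₗ[Hᵐᵒᵖ] H := J.liftQ G hG
  have hg : ∀ z, g (q z) = ι t * F z := fun z => rfl
  obtain ⟨z, hz⟩ := J.mkQ_surjective (i ⟨n₀, hn.left⟩)
  have hz' : q z = i ⟨n₀, hn.left⟩ := hz
  refine ⟨F z, ?_, fun h => ?_⟩
  · rw [hεF, hz']
    have : p (i ⟨n₀, hn.left⟩) = ⟨n₀, hn.left⟩ := congr($hpi ⟨n₀, hn.left⟩)
    rw [this]
    exact hn.apply_eq_one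
  -- The maps are only known to be `Hᵐᵒᵖ`-linear, so the scalar `ε(h)` has to act as an element of
  -- `H`.
  · have e : MulOpposite.op h • (⟨n₀, hn.left⟩ : rightIntegrals k H) =
        MulOpposite.op (algebraMap k H (counit (R := k) h)) • ⟨n₀, hn.left⟩ := by
      ext
      change n₀ * h = n₀ * algebraMap k H _
      rw [hn.left, hn.left, Bialgebra.counit_algebraMap]
    have h1 := congr(g (i $e))
    rw [map_smul, map_smul, map_smul, map_smul, ← hz', hg] at h1
    simpa [MulOpposite.smul_eq_mul_unop, Algebra.algebraMap_eq_smul_one] using h1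

/-- Mirror image of the right-handed argument, with trivial left modules and right multiplication by
`ι t`. -/
theorem exists_of_isLeftSemisimpleExtension (ι : R →ₐc[k] H)
    (hss : RingExt.IsLeftSemisimpleExtension (ι : R →+* H)) {t : R} (ht : IsLeftIntegral k t) :
    ∃ s : H, counit (R := k) s = 1 ∧ IsLeftIntegral k (s * ι t) := by
  obtain ⟨n₀, hn0, hn⟩ := exists_isLeftIntegral k H
  obtain ⟨ξ, hξ⟩ : ∃ ξ : Module.Dual k H, ξ n₀ = 1 := by
    obtain ⟨g, hg⟩ : ∃ g : Module.Dual k H, g n₀ ≠ 0 := by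
      by_contra! h
      exact hn0 ((Module.forall_dual_apply_eq_zero_iff k n₀).mp h)
    exact ⟨(g n₀)⁻¹ • g, by simp [hg]⟩
  obtain ⟨i, p, hpi⟩ := hss (leftIntegrals k H)
  let J := (Submodule.span H
    {x : H ⊗[ℤ] (leftIntegrals k H) | ∃ (b : R) (a : H) (n : leftIntegrals k H),
      x = (a * (ι : R →+* H) b) ⊗ₜ[ℤ] n - a ⊗ₜ[ℤ] ((ι : R →+* H) b • n)})
  let q : H ⊗[ℤ] (leftIntegrals k H) →ₗ[H]
    RingExt.InducedLeft (ι : R →+* H) (leftIntegrals k H) := J.mkQ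
  let f : leftIntegrals k H →+ k :=
    { toFun n := ξ (p (q (1 ⊗ₜ n)) : H)
      map_zero' := by simp
      map_add' x y := by simp [TensorProduct.tmul_add] }
  have hpq : ∀ (a : H) (n : leftIntegrals k H),
      (p (q (a ⊗ₜ n)) : H) = counit (R := k) a • (p (q (1 ⊗ₜ n)) : H) := by
    intro a n
    have : a ⊗ₜ[ℤ] n = a • ((1 : H) ⊗ₜ[ℤ] n) := by
      rw [TensorProduct.smul_tmul', smul_eq_mul, mul_one]
    rw [this, map_smul, map_smul]
    exact (p (q (1 ⊗ₜ n))).2 a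
  have hf : ∀ (b : R) (n : leftIntegrals k H),
      f (ι b • n) = counit (R := k) b * f n := by
    intro b n
    have : q ((ι b) ⊗ₜ n) = q (1 ⊗ₜ (ι b • n)) := by
      rw [← sub_eq_zero, ← map_sub]
      refine (Submodule.Quotient.mk_eq_zero _).mpr (Submodule.subset_span ⟨b, 1, n, ?_⟩)
      rw [one_mul]
      rfl
    change ξ (p (q (1 ⊗ₜ _)) : H) = _ * ξ (p (q (1 ⊗ₜ n)) : H)
    rw [← this, hpq, map_smul, smul_eq_mul, CoalgHomClass.counit_comp_apply]
  let F : H ⊗[ℤ] (leftIntegrals k H) →ₗ[H] H := TensorProduct.AlgebraTensorModule.lift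
    { toFun a :=
        { toFun n := f n • a
          map_add' := by simp [add_smul]
          map_smul' m n := by rw [map_zsmul, smul_assoc, RingHom.id_apply] }
      map_add' a b := by ext; simp
      map_smul' c a := by ext; simp }
  have hF : ∀ a n, F (a ⊗ₜ n) = f n • a := fun a n => rfl
  have hεF : ∀ z, counit (R := k) (F z) = ξ (p (q z) : H) := by
    intro z
    induction z with
    | zero => simp
    | add x y hx hy => simp only [map_add, hx, hy, Submodule.coe_add]
    | tmul a n =>
      rw [hpq, hF, map_smul, map_smul, smul_eq_mul, smul_eq_mul, mul_comm]
      rfl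
  let G : H ⊗[ℤ] (leftIntegrals k H) →ₗ[H] H :=
    { toFun z := F z * ι t
      map_add' := by simp [add_mul]
      map_smul' c z := by simp [mul_assoc] }
  have hG : J ≤ LinearMap.ker G := by
    refine Submodule.span_le.mpr ?_
    rintro _ ⟨b, a, n, rfl⟩
    rw [SetLike.mem_coe, LinearMap.mem_ker, map_sub, sub_eq_zero]
    change F ((a * ι b) ⊗ₜ n) * ι t = F (a ⊗ₜ (ι b • n)) * ι t
    rw [hF, hF, hf, smul_mul_assoc, mul_assoc, ← map_mul, ht, map_smul, mul_smul_comm, smul_smul,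
      smul_mul_assoc, mul_comm]
  let g : RingExt.InducedLeft (ι : R →+* H) (leftIntegrals k H) →ₗ[H] H := J.liftQ G hG
  have hg : ∀ z, g (q z) = F z * ι t := fun z => rfl
  obtain ⟨z, hz⟩ := J.mkQ_surjective (i ⟨n₀, hn⟩)
  have hz' : q z = i ⟨n₀, hn⟩ := hz
  refine ⟨F z, ?_, fun h => ?_⟩
  · rw [hεF, hz']
    have : p (i ⟨n₀, hn⟩) = ⟨n₀, hn⟩ := congr($hpi ⟨n₀, hn⟩)
    rw [this]
    exact hξ
  · have e : h • (⟨n₀, hn⟩ : leftIntegrals k H) =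
        (algebraMap k H (counit (R := k) h)) • ⟨n₀, hn⟩ := by
      ext
      change h * n₀ = algebraMap k H _ * n₀
      rw [hn, hn, Bialgebra.counit_algebraMap]
    have h1 := congr(g (i $e))
    rw [map_smul, map_smul, map_smul, map_smul, ← hz', hg] at h1
    simpa [Algebra.algebraMap_eq_smul_one] using h1

/-- For a semisimple extension `H ⊇ R`, some nonzero right integral of `H` is a right multiple of a
right integral of `R`. -/
theorem exists_isRightIntegral_map_mul [FiniteDimensional k R] (ι : R →ₐc[k] H)
    (hι : Function.Injective ι)
    (hss : RingExt.IsRightSemisimpleExtension (ι : R →+* H) ∨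
      RingExt.IsLeftSemisimpleExtension (ι : R →+* H)) :
    ∃ (t : R) (s : H), IsRightIntegral k t ∧ ι t * s ≠ 0 ∧ IsRightIntegral k (ι t * s) := by
  obtain ⟨l, hl0, hl⟩ := exists_isLeftIntegral k R
  have hSR := (hl.exists_isDualPair hl0).1
  have hSH : Function.Bijective (antipode k (A := H)) := by
    obtain ⟨t, ht0, ht⟩ := exists_isLeftIntegral k H
    exact (ht.exists_isDualPair ht0).1
  have hr := hl.antipode hSR.2
  -- The product is `S(s l)`, and `s l = 0` would force `ε(s) = 0`.
  have key : ∀ s : H, counit (R := k) s = 1 → ι (antipode k l) * antipode k s ≠ 0 := by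
    intro s hs h0
    rw [map_antipode, ← antipode_mul_antidistrib] at h0
    have := hl.counit_eq_zero_of_mul_eq_zero ι hι hl0 (hSH.1 (h0.trans (map_zero _).symm))
    exact one_ne_zero (hs.symm.trans this)
  rcases hss with hss | hss
  · obtain ⟨s, hs1, hs⟩ := exists_of_isRightSemisimpleExtension ι hss hr
    obtain ⟨s', rfl⟩ := hSH.2 s
    exact ⟨_, _, hr, key s' (by rwa [counit_antipode] at hs1), hs⟩
  · obtain ⟨s, hs1, hs⟩ := exists_of_isLeftSemisimpleExtension ι hss hl
    refine ⟨_, _, hr, key s hs1, ?_⟩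
    rw [map_antipode, ← antipode_mul_antidistrib]
    exact hs.antipode hSH.2

end Semisimple

/-! ### Restriction to `R` and the Frobenius system -/

section Frobenius

variable {k R H : Type*} [Field k] [Ring R] [HopfAlgebra k R] [Ring H] [HopfAlgebra k H]

theorem IsIntegralPair.mul_eq_modular_smul_of_isRightIntegral {t : H} {φ : Module.Dual k H}
    (h : IsIntegralPair t φ) {s : H} (hs : IsRightIntegral k s) (a : H) :
    a * s = h.modular a • s := by
  rw [h.eq_smul hs, mul_smul_comm, h.mul_eq_modular_smul, smul_comm]

theorem IsIntegralPair.map_mul_eq_of_isRightIntegralOn [FiniteDimensional k H] {t : H}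
    {φ : Module.Dual k H} (h : IsIntegralPair t φ) {ψ : Module.Dual k H} (hψ : IsRightIntegralOn ψ)
    (a b : H) : ψ (a * b) = ψ (h.nakayama b * a) := by
  rw [h.functional_eq_smul hψ, LinearMap.smul_apply, LinearMap.smul_apply, h.map_mul_eq]

theorem modular_map (ι : R →ₐc[k] H) {t : R} {s : H} (ht : IsRightIntegral k t)
    (hs0 : ι t * s ≠ 0) (hs : IsRightIntegral k (ι t * s)) {tR : R} {φR : Module.Dual k R}
    (hR : IsIntegralPair tR φR) {tH : H} {φH : Module.Dual k H} (hH : IsIntegralPair tH φH)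
    (r : R) : hH.modular (ι r) = hR.modular r := by
  have h1 := hH.mul_eq_modular_smul_of_isRightIntegral hs (ι r)
  rw [← mul_assoc, ← map_mul, hR.mul_eq_modular_smul_of_isRightIntegral ht, map_smul,
    smul_mul_assoc, ← sub_eq_zero, ← sub_smul, smul_eq_zero, or_iff_left hs0, sub_eq_zero] at h1
  exact h1.symm

/-- Both sides of the formula for `S²` restrict to `R` once the modular functions agree. Thus `S²`
takes the same value at `ι r` and at `η_H⁻¹(ι(η_R r))`, and `S²` is injective. -/
theorem nakayama_map [FiniteDimensional k R] [FiniteDimensional k H] (ι : R →ₐc[k] H) {tR : R}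
    {φR : Module.Dual k R} (hR : IsIntegralPair tR φR) {tH : H} {φH : Module.Dual k H}
    (hH : IsIntegralPair tH φH) (hm : ∀ r : R, hH.modular (ι r) = hR.modular r) (r : R) :
    hH.nakayama (ι r) = ι (hR.nakayama r) := by
  have hL : ∀ x : R, TensorProduct.lid k H (hH.modular.toLinearMap.rTensor H (comul (ι x))) =
      ι (TensorProduct.lid k R (hR.modular.toLinearMap.rTensor R (comul x))) := by
    intro x
    rw [← CoalgHomClass.map_comp_comul_apply, ← (ℛ k x).eq]
    simp [hm]
  have h1 := hH.antipode_antipode (hH.nakayama.symm (ι (hR.nakayama r)))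
  rw [hH.nakayama.apply_symm_apply, hL, ← hR.antipode_antipode, map_antipode, map_antipode] at h1
  have h2 := hH.antipode_injective (hH.antipode_injective h1)
  rw [← hH.nakayama.apply_symm_apply (ι (hR.nakayama r)), h2]

theorem IsDualPair.lid_map_comul {t : H} {φ : Module.Dual k H} {n : ℕ} {x y : Fin n → H}
    (h : IsDualPair t φ x y) (a : H) :
    TensorProduct.lid k H (TensorProduct.map (φ ∘ₗ LinearMap.mulLeft k a) (antipode k)
      (comul t)) = a := by
  conv_rhs => rw [← h.sum_smul_antipode a]
  rw [h.comul_eq]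
  simp

theorem isFrobeniusExtension [FiniteDimensional k R] [FiniteDimensional k H] (ι : R →ₐc[k] H)
    (hι : Function.Injective ι) {tR : R} {φR' : Module.Dual k R} (hR : IsIntegralPair tR φR')
    {tH : H} {φH' : Module.Dual k H} (hH : IsIntegralPair tH φH')
    (hη : ∀ r : R, hH.nakayama (ι r) = ι (hR.nakayama r)) :
    RingExt.IsFrobeniusExtension (ι : R →+* H) := by
  obtain ⟨l, hl0, hl⟩ := exists_isLeftIntegral k R
  obtain ⟨-, φR, n, x, y, hd, hφR⟩ := hl.exists_isDualPair hl0
  obtain ⟨t, ht0, ht⟩ := exists_isLeftIntegral k H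
  obtain ⟨-, φH, _, _, _, hdH, hφH⟩ := ht.exists_isDualPair ht0
  obtain ⟨z, rfl⟩ := hl.exists_map_mul_eq ι hι hl0 ht
  have hηR := hR.map_mul_eq_of_isRightIntegralOn hφR
  have hηH := hH.map_mul_eq_of_isRightIntegralOn hφH
  let E : H →+ R :=
    { toFun h := ∑ i, φH (h * ι (x i)) • antipode k (y i)
      map_zero' := by simp
      map_add' a b := by simp [add_mul, add_smul, Finset.sum_add_distrib] }
  have hE : ∀ (h : H) (r : R), φR (E h * r) = φH (h * ι r) := by
    intro h r
    conv_rhs => rw [← hd.sum_smul r]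
    simp [E, Finset.sum_mul, Finset.mul_sum, mul_comm]
  have hφE : ∀ h : H, φR (E h) = φH h := fun h => by simpa using hE h 1
  have hext : ∀ a b : R, (∀ r, φR (a * r) = φR (b * r)) → a = b := fun a b hab => by
    rw [← sub_eq_zero]
    exact hd.eq_zero_of_mul_right fun r => by rw [sub_mul, map_sub, hab, sub_self]
  have hEr : ∀ (h : H) (r : R), E (h * ι r) = E h * r := fun h r => hext _ _ fun s => by
    rw [hE, mul_assoc, ← map_mul, mul_assoc, hE]
  -- Writing `r = η_R(r')`, the Nakayama identity moves `r'` to the other end of both functionals,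
  -- which reduces the claim to the defining property of `E`.
  have hEl : ∀ (r : R) (h : H), E (ι r * h) = r * E h := fun r h => hext _ _ fun s => by
    obtain ⟨r', rfl⟩ := hR.nakayama.surjective r
    rw [hE, ← hη, mul_assoc, ← hηH, mul_assoc _ (E h), ← hηR, mul_assoc, ← map_mul, ← hE, mul_assoc]
  let b := Module.finBasis k H
  obtain ⟨v, hv⟩ := TensorProduct.eq_repr_basis_left b (comul (R := k) z)
  rw [Finsupp.sum_fintype _ _ (by simp)] at hv
  -- With `t = l z`, the dual basis expansion of `a` is `∑ φ_H(a x i b j) S(v j) S(y i)`. Moving `b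
  -- j` to the front by `η_H` turns the sum over `i` into `E(η_H(b j) a)`.
  have h2 : ∀ a : H, ∑ j, antipode k (v j) * ι (E (hH.nakayama (b j) * a)) = a := by
    intro a
    have h := hdH.lid_map_comul a
    rw [Bialgebra.comul_mul, ← hv, ← CoalgHomClass.map_comp_comul_apply, hd.comul_eq] at h
    conv_rhs => rw [← h]
    simp only [map_sum, TensorProduct.map_tmul, Finset.sum_mul_sum,
      Algebra.TensorProduct.tmul_mul_tmul, LinearMap.comp_apply, LinearMap.mulLeft_apply,
      TensorProduct.lid_tmul]
    rw [Finset.sum_comm]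
    refine Finset.sum_congr rfl fun j _ => ?_
    simp only [E, AddMonoidHom.coe_mk, ZeroHom.coe_mk, map_sum, map_smul, Finset.mul_sum]
    refine Finset.sum_congr rfl fun i _ => ?_
    have : φH (a * (ι (x i) * b j)) = φH (hH.nakayama (b j) * a * ι (x i)) := by
      rw [← mul_assoc, hηH, mul_assoc]
    simp [antipode_mul_antidistrib, map_antipode, this]
  refine ⟨E, _, fun j => antipode k (v j), fun j => hH.nakayama (b j), ?_, ?_, h2⟩
  · intro r a r'
    change E (ι r * a * ι r') = _
    rw [hEr, hEl]
  -- The other identity follows by testing against `φ_H(· c)` and expanding `c` by `h2`: both sides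
  -- become sums of `φ_R(E(a x j) E(y j c))`, where `x j = S(v j)` and `y j = η_H(b j)`.
  · intro a
    rw [← sub_eq_zero]
    refine hdH.eq_zero_of_mul_right fun c => ?_
    rw [sub_mul, map_sub, sub_eq_zero]
    conv_rhs => rw [← h2 c]
    rw [Finset.sum_mul, Finset.mul_sum, map_sum, map_sum]
    refine Finset.sum_congr rfl fun j _ => ?_
    change φH (ι (E _) * _ * c) = _
    rw [← hφE, mul_assoc, hEl, ← hEr, hφE, mul_assoc]

end Frobenius

end HopfInt

theorem mainTheorem2 {k R H : Type*} [Field k] [Ring R] [Ring H]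
    [HopfAlgebra k R] [HopfAlgebra k H] [FiniteDimensional k R] [FiniteDimensional k H]
    (ι : R →ₐc[k] H) (hι : Function.Injective ι)
    (hss : RingExt.IsRightSemisimpleExtension (ι : R →+* H) ∨
      RingExt.IsLeftSemisimpleExtension (ι : R →+* H)) :
    ((∃! mH : H →ₐ[k] k, HopfInt.IsModularFunction mH) ∧
      (∃! mR : R →ₐ[k] k, HopfInt.IsModularFunction mR) ∧
      (∀ (mH : H →ₐ[k] k) (mR : R →ₐ[k] k),
        HopfInt.IsModularFunction mH → HopfInt.IsModularFunction mR →
          ∀ r : R, mH (ι r) = mR r)) ∧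
    ((∃! ηH : H ≃ₐ[k] H, HopfInt.IsNakayamaAutomorphism ηH) ∧
      (∃! ηR : R ≃ₐ[k] R, HopfInt.IsNakayamaAutomorphism ηR) ∧
      (∀ (ηH : H ≃ₐ[k] H) (ηR : R ≃ₐ[k] R),
        HopfInt.IsNakayamaAutomorphism ηH → HopfInt.IsNakayamaAutomorphism ηR →
          ∀ r : R, ηH (ι r) = ι (ηR r))) ∧
    RingExt.IsFrobeniusExtension (ι : R →+* H) := by
  obtain ⟨tR, φR, hR⟩ := HopfInt.exists_isIntegralPair k R
  obtain ⟨tH, φH, hH⟩ := HopfInt.exists_isIntegralPair k H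
  obtain ⟨t, s, ht, hs0, hs⟩ := HopfInt.exists_isRightIntegral_map_mul ι hι hss
  have hm := HopfInt.modular_map ι ht hs0 hs hR hH
  have hη := HopfInt.nakayama_map ι hR hH hm
  simp only [hR.isModularFunction_iff, hH.isModularFunction_iff, hR.isNakayamaAutomorphism_iff,
    hH.isNakayamaAutomorphism_iff, existsUnique_eq, true_and]
  refine ⟨?_, ?_, HopfInt.isFrobeniusExtension ι hι hR hH hη⟩
  · rintro _ _ rfl rfl
    exact hm
  · rintro _ _ rfl rfl
    exact hη
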